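/- Let $s>1$, let $U\subset\mathbb R$ be an open neighbourhood of $0$, and let $c:U\to\mathbb R$ belong to the Gevrey class $G^s(U)$, i.e. $c$ is smooth and there are $K,A>0$ with $|c^{(m)}(\theta)|\le K A^m (m!)^s$ for all $\theta\in U$ and all $m\in\mathbb N$ (including $m=0$). Suppose $c(0)=1$ and $c^{(m)}(0)=0$ for all $m\ge 1$. Let $\varphi\in C_b^2(\mathbb R)$ and $\psi\in C_b^1(\mathbb R)$, where $C_b^m(\mathbb R)$ is the set of $C^m$ functions that are bounded together with their derivatives up to order $m$. For $\varepsilon>0$ consider the Cauchy problem $$u_{tt}-c(u_x)^2u_{xx}=0,\qquad u(0,x)=\varepsilon\varphi(x),\quad u_t(0,x)=\varepsilon\psi(x)\qquad(x\in\mathbb R),$$ and let its lifespan $T^*=T^*(\varepsilon)\in[0,\infty]$ be the supremum of all real $T>0$ for which there is a classical ($C^2$) solution $u$ on $[0,T)\times\mathbb R$, with $u_x$ taking values in $U$ and $c(u_x)\neq 0$, such that $$\sup_{t\in[0,T)}\Bigl(\|u(t)\|_{L^\infty}+\|u_t(t)\|_{L^\infty}+\|u_x(t)\|_{L^\infty}+\|u_{tt}(t)\|_{L^\infty}+\|u_{tx}(t)\|_{L^\infty}+\|u_{xx}(t)\|_{L^\infty}+\|c(u_x(t))^{-1}\|_{L^\infty}\Bigr)<\infty$$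 ($\sup\emptyset=0$). (a) There are constants $\varepsilon_0,C_1,C_2>0$ such that for all $0<\varepsilon\le\varepsilon_0$, $$C_1\exp\bigl(C_2\,\varepsilon^{-1/(s-1)}\bigr)\le T^*(\varepsilon).$$ (b) Suppose moreover that there are constants $C,C'>0$ with $C\exp\bigl(-C'|\theta|^{-1/(s-1)}\bigr)\le c'(\theta)$ for all $\theta\ne 0$ in some neighbourhood of $0$, that $\varphi_x(x)\to0$ and $\psi(x)\to 0$ as $|x|\to\infty$, and that there is a point $x_0\in\mathbb R$ with $\psi_x(x_0)+\varphi_{xx}(x_0)>0$ or $\psi_x(x_0)-\varphi_{xx}(x_0)>0$. Then there are constants $\varepsilon_0,C_3,C_4>0$ such that for all $0<\varepsilon\le\varepsilon_0$, $$T^*(\varepsilon)\le C_3\exp\bigl(C_4\,\varepsilon^{-1/(s-1)}\bigr).$$ The constants do not depend on $\varepsilon$. -/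

import Mathlib

open Set Filter Topology
open scoped ContDiff

/-- `f ∈ C_b^m(ℝ)`: `f` is `m` times continuously differentiable and `f` and all its derivatives
up to order `m` are bounded on `ℝ`. -/
def MemCb (m : ℕ) (f : ℝ → ℝ) : Prop :=
  ContDiff ℝ m f ∧ ∀ k ≤ m, ∃ M : ℝ, ∀ x, |iteratedDeriv k f x| ≤ M

/-- The Gevrey class `G^s(Ω)` (for `Ω` open): smooth functions on `Ω` with
`|f^{(m)}(θ)| ≤ C A^m (m!)^s` for all `θ ∈ Ω` and all `m`, with `C`, `A` independent of `m`, `θ`. -/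
def MemGevrey (s : ℝ) (Ω : Set ℝ) (f : ℝ → ℝ) : Prop :=
  ContDiffOn ℝ ∞ f Ω ∧
    ∃ C > 0, ∃ A > 0, ∀ m : ℕ, ∀ θ ∈ Ω,
      |iteratedDeriv m f θ| ≤ C * A ^ m * (m.factorial : ℝ) ^ s

/-- `u` is a classical (`C²`) solution on `[0,T) × ℝ` of `u_tt - c(u_x)² u_xx = 0`,
`u(0,·) = f`, `u_t(0,·) = g`, with partial derivatives
`ut = ∂_t u`, `ux = ∂_x u`, `utt = ∂_t² u`, `utx = ∂_x ∂_t u = ∂_t ∂_x u`, `uxx = ∂_x² u`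
(one-sided in time at `t = 0`), all continuous on `[0,T) × ℝ`.
The wave speed `c` is only meaningful on `U`, so `u_x` is required to take its values there. -/
structure IsClassicalSolution (c : ℝ → ℝ) (U : Set ℝ) (f g : ℝ → ℝ) (T : ℝ)
    (u ut ux utt utx uxx : ℝ → ℝ → ℝ) : Prop where
  cont_u : ContinuousOn (fun p : ℝ × ℝ => u p.1 p.2) (Ico 0 T ×ˢ univ)
  cont_ut : ContinuousOn (fun p : ℝ × ℝ => ut p.1 p.2) (Ico 0 T ×ˢ univ)
  cont_ux : ContinuousOn (fun p : ℝ × ℝ => ux p.1 p.2) (Ico 0 T ×ˢ univ)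
  cont_utt : ContinuousOn (fun p : ℝ × ℝ => utt p.1 p.2) (Ico 0 T ×ˢ univ)
  cont_utx : ContinuousOn (fun p : ℝ × ℝ => utx p.1 p.2) (Ico 0 T ×ˢ univ)
  cont_uxx : ContinuousOn (fun p : ℝ × ℝ => uxx p.1 p.2) (Ico 0 T ×ˢ univ)
  deriv_t : ∀ t ∈ Ico 0 T, ∀ x, HasDerivWithinAt (fun τ => u τ x) (ut t x) (Ico 0 T) t
  deriv_x : ∀ t ∈ Ico 0 T, ∀ x, HasDerivAt (fun y => u t y) (ux t x) x
  deriv_tt : ∀ t ∈ Ico 0 T, ∀ x, HasDerivWithinAt (fun τ => ut τ x) (utt t x) (Ico 0 T) t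
  deriv_tx : ∀ t ∈ Ico 0 T, ∀ x, HasDerivAt (fun y => ut t y) (utx t x) x
  deriv_xt : ∀ t ∈ Ico 0 T, ∀ x, HasDerivWithinAt (fun τ => ux τ x) (utx t x) (Ico 0 T) t
  deriv_xx : ∀ t ∈ Ico 0 T, ∀ x, HasDerivAt (fun y => ux t y) (uxx t x) x
  mem_domain : ∀ t ∈ Ico 0 T, ∀ x, ux t x ∈ U
  equation : ∀ t ∈ Ico 0 T, ∀ x, utt t x - c (ux t x) ^ 2 * uxx t x = 0
  initial_u : ∀ x, u 0 x = f x
  initial_ut : ∀ x, ut 0 x = g x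

/-- The Cauchy problem has a classical solution on `[0,T) × ℝ` for which
`‖u‖ + ‖u_t‖ + ‖u_x‖ + ‖u_tt‖ + ‖u_tx‖ + ‖u_xx‖ + ‖c(u_x)⁻¹‖` (sup norms in `x`) is bounded
for `t ∈ [0,T)`. -/
def HasBoundedSolution (c : ℝ → ℝ) (U : Set ℝ) (f g : ℝ → ℝ) (T : ℝ) : Prop :=
  ∃ u ut ux utt utx uxx : ℝ → ℝ → ℝ,
    IsClassicalSolution c U f g T u ut ux utt utx uxx ∧
    ∃ M : ℝ, ∀ t ∈ Ico 0 T, ∀ x,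
      |u t x| ≤ M ∧ |ut t x| ≤ M ∧ |ux t x| ≤ M ∧
      |utt t x| ≤ M ∧ |utx t x| ≤ M ∧ |uxx t x| ≤ M ∧
      c (ux t x) ≠ 0 ∧ |(c (ux t x))⁻¹| ≤ M

/-- The lifespan `T* ∈ [0,∞]` of the Cauchy problem with data `u(0,·) = f`, `u_t(0,·) = g`
(`sSup ∅ = 0` if there is no solution at all). -/
noncomputable def lifespan (c : ℝ → ℝ) (U : Set ℝ) (f g : ℝ → ℝ) : ENNReal :=
  sSup {τ : ENNReal | ∃ T : ℝ, 0 < T ∧ HasBoundedSolution c U f g T ∧ τ = ENNReal.ofReal T}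

open scoped NNReal BoundedContinuousFunction

/-! Put `v = u_x`, `w = u_t`, and let `F` be the primitive of the wave speed with `F 0 = 0`. The
equation becomes `v_t = w_x`, `w_t = c(v)² v_x`, and the Riemann invariants `S = w + F(v)`, `R = w -
F(v)` are carried unchanged along the characteristics `X' = -c(v)` and `X' = c(v)`. Hence `v` stays
of size `ε`, and derivatives can grow only through `c'(v)`. Taylor's formula at the flat point, with
the Gevrey bounds and an order comparable to `|θ|^(-1/(s-1))`, makes `c'(θ)` exponentially small
(`exists_flat_bound`). Near `0`, `c` is replaced by a globally defined speed `k` close to `1`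
(`exists_global_speed`).

Lower bound: in characteristic coordinates `α`, `β` the invariants are the initial ones, `S(α)` and
`R(β)`, so the speed is an explicit function `Λ(α, β)` with `|Λ_α|, |Λ_β| ≤ η`, where `η` bounds
`c'` on the range of `v`. The nonlinear problem reduces to a linear Goursat problem for `t` as a
function of `(α, β)`, solvable by contraction on a strip of width `1/(100 η)`
(`exists_char_densities`). Inverting the coordinates (`exists_char_coords`) gives a classical
solution up to a time of order `1/η` (`hasBoundedSolution_of_slow_speed`).

Upper bound: along an `S`-characteristic, `Y = √c · S_x` satisfies `Y' = c' Y² / (2 c √c)`, so a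
positive `Y` blows up once `c'` has been bounded below for long enough (`time_le`). The start `a` is
chosen with `S_x > 0` and `|S|` of order `ε`. After a fixed time the crossing `R`-characteristics
come from far to the left, where the data are negligible. Then `2 F(v) = S - R` is of order `ε`, and
the assumed lower bound on `c'` applies (`lifespan_le_of_exists_pos`). The other sign condition
follows by reflection in `x`. -/

/-! ### Closed one-forms and primitives on a diagonal strip. -/

/-- Differentiation under an interval integral with fixed endpoints. -/
theorem hasDerivAt_intervalIntegral_param {P W : ℝ × ℝ → ℝ} (hP : Continuous P)
    (hW : Continuous W) {M : ℝ} (hM : ∀ z, |W z| ≤ M) {a₀ a₁ b₀ r : ℝ} (hr : 0 < r)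
    (hd : ∀ y ∈ uIcc a₀ a₁, ∀ b ∈ Metric.ball b₀ r, HasDerivAt (fun b => P (y, b)) (W (y, b)) b) :
    HasDerivAt (fun b => ∫ y in a₀..a₁, P (y, b)) (∫ y in a₀..a₁, W (y, b₀)) b₀ := by
  refine (intervalIntegral.hasDerivAt_integral_of_dominated_loc_of_deriv_le
    (F := fun b y => P (y, b)) (F' := fun b y => W (y, b)) (bound := fun _ => M)
    (Metric.ball_mem_nhds b₀ hr) ?_ ?_ ?_ ?_ ?_ ?_).2
  · exact Eventually.of_forall fun b => (by fun_prop : Continuous fun y => P (y, b)).aestronglyMeasurable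
  · exact (by fun_prop : Continuous fun y => P (y, b₀)).intervalIntegrable _ _
  · exact (by fun_prop : Continuous fun y => W (y, b₀)).aestronglyMeasurable
  · exact Eventually.of_forall fun y _ b _ => by simpa using hM (y, b)
  · exact intervalIntegrable_const
  · exact Eventually.of_forall fun y hy b hb => hd y (uIoc_subset_uIcc hy) b hb

/-- A function with continuous partial derivatives on an open set is strictly differentiable. -/
theorem hasStrictFDerivAt_of_partials {f fa fb : ℝ × ℝ → ℝ} {s : Set (ℝ × ℝ)} (hs : IsOpen s)
    (hfa : ContinuousOn fa s) (hfb : ContinuousOn fb s)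
    (ha : ∀ z ∈ s, HasDerivAt (fun a => f (a, z.2)) (fa z) z.1)
    (hb : ∀ z ∈ s, HasDerivAt (fun b => f (z.1, b)) (fb z) z.2) {z : ℝ × ℝ} (hz : z ∈ s) :
    HasStrictFDerivAt f
      (fa z • ContinuousLinearMap.fst ℝ ℝ ℝ + fb z • ContinuousLinearMap.snd ℝ ℝ ℝ) z := by
  have key := hasStrictFDerivAt_uncurry_coprod (𝕜 := ℝ) (u := z) (f := fun a b => f (a, b))
    (f₁ := fun a b => ContinuousLinearMap.toSpanSingleton ℝ (fa (a, b)))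
    (f₂ := fun a b => ContinuousLinearMap.toSpanSingleton ℝ (fb (a, b)))
    (by filter_upwards [hs.mem_nhds hz] with w hw using (ha w hw).hasFDerivAt)
    (by filter_upwards [hs.mem_nhds hz] with w hw using (hb w hw).hasFDerivAt)
    (by
      have h1 : ContinuousAt fa z := hfa.continuousAt (hs.mem_nhds hz)
      exact ((ContinuousLinearMap.toSpanSingletonCLE (𝕜 := ℝ) (E := ℝ)).continuous.continuousAt).comp h1)
    (by
      have h1 : ContinuousAt fb z := hfb.continuousAt (hs.mem_nhds hz)
      exact ((ContinuousLinearMap.toSpanSingletonCLE (𝕜 := ℝ) (E := ℝ)).continuous.continuousAt).comp h1)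
  refine key.congr_fderiv ?_
  ext <;> simp [Function.HasUncurry.uncurry]

/-- The open diagonal strip `|a - b| < L`. -/
def diagStrip (L : ℝ) : Set (ℝ × ℝ) := {z | |z.1 - z.2| < L}

theorem isOpen_diagStrip (L : ℝ) : IsOpen (diagStrip L) :=
  isOpen_lt (by fun_prop) continuous_const

theorem convex_diagStrip (L : ℝ) : Convex ℝ (diagStrip L) := by
  have : diagStrip L = (fun z : ℝ × ℝ => z.1 - z.2) ⁻¹' Metric.ball 0 L := by
    ext z; simp [diagStrip]
  rw [this]
  exact (convex_ball (0 : ℝ) L).is_linear_preimage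
    (IsLinearMap.mk (fun x y => by simp; ring) (fun c x => by simp; ring))

/-- Potential of a closed one-form `P da + Q db` on a diagonal strip, where only the mixed
derivatives `∂_b P = ∂_a Q = W` are available, with prescribed values on the diagonal. -/
theorem exists_potential_strip {P Q W : ℝ × ℝ → ℝ} (hP : Continuous P) (hQ : Continuous Q)
    (hW : Continuous W) {M L : ℝ} (hM : ∀ z, |W z| ≤ M)
    (hPW : ∀ z ∈ diagStrip L, HasDerivAt (fun b => P (z.1, b)) (W z) z.2)
    (hQW : ∀ z ∈ diagStrip L, HasDerivAt (fun a => Q (a, z.2)) (W z) z.1)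
    {D : ℝ → ℝ} (hD : ∀ a, HasDerivAt D (P (a, a) + Q (a, a)) a) :
    ∃ f : ℝ × ℝ → ℝ, (∀ a, f (a, a) = D a) ∧ ∀ z ∈ diagStrip L, HasStrictFDerivAt f
      (P z • ContinuousLinearMap.fst ℝ ℝ ℝ + Q z • ContinuousLinearMap.snd ℝ ℝ ℝ) z := by
  -- Only `P` is integrated. In the `b`-derivative the moving lower endpoint contributes `-P (b,
  -- b)`, and the integral of `W = ∂_a Q` contributes `Q (a, b) - Q (b, b)`; with `D' = P + Q` on
  -- the diagonal exactly `Q (a, b)` remains.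
  refine ⟨fun z => D z.2 + ∫ y in z.2..z.1, P (y, z.2), by simp, fun z hz => ?_⟩
  refine hasStrictFDerivAt_of_partials (isOpen_diagStrip L) hP.continuousOn hQ.continuousOn ?_ ?_ hz
  · rintro ⟨a, b⟩ -
    have hc : Continuous fun y => P (y, b) := by fun_prop
    simpa using (intervalIntegral.integral_hasDerivAt_right (hc.intervalIntegrable b a)
      hc.aestronglyMeasurable.stronglyMeasurableAtFilter hc.continuousAt).const_add (D b)
  · rintro ⟨a, b⟩ hab
    simp only [diagStrip, mem_ofPred_eq] at hab
    -- split the integral at the base point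
    have hsplit : (fun b' => D b' + ∫ y in b'..a, P (y, b')) = fun b' =>
        D b' + ((∫ y in b..a, P (y, b')) - ∫ y in b..b', P (y, b')) := by
      funext b'
      have hc : Continuous fun y => P (y, b') := by fun_prop
      rw [intervalIntegral.integral_interval_sub_left (hc.intervalIntegrable _ _)
        (hc.intervalIntegrable _ _)]
    have hr : 0 < L - |a - b| := by linarith
    have h1 : HasDerivAt (fun b' => ∫ y in b..a, P (y, b')) (∫ y in b..a, W (y, b)) b := by
      refine hasDerivAt_intervalIntegral_param hP hW hM hr fun y hy b' hb' => ?_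
      refine hPW (y, b') ?_
      rw [Metric.mem_ball, Real.dist_eq] at hb'
      have h2 : |y - b| ≤ |a - b| := abs_sub_left_of_mem_uIcc hy
      simp only [diagStrip, mem_ofPred_eq]
      calc |y - b'| = |(y - b) - (b' - b)| := by ring_nf
        _ ≤ |y - b| + |b' - b| := abs_sub _ _
        _ < L := by linarith
    have h2 : ∫ y in b..a, W (y, b) = Q (a, b) - Q (b, b) := by
      refine intervalIntegral.integral_eq_sub_of_hasDerivAt (f := fun y => Q (y, b)) (fun y hy => ?_)
        ((by fun_prop : Continuous fun y => W (y, b)).intervalIntegrable _ _)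
      refine hQW (y, b) ?_
      exact lt_of_le_of_lt (abs_sub_left_of_mem_uIcc hy) hab
    -- Endpoint and parameter move together; the interval has length `|b' - b|`, so continuity of
    -- `P` at `(b, b)` suffices.
    have h3 : HasDerivAt (fun b' => ∫ y in b..b', P (y, b')) (P (b, b)) b := by
      rw [hasDerivAt_iff_isLittleO, Asymptotics.isLittleO_iff]
      intro e he
      have hc : ContinuousAt P (b, b) := hP.continuousAt
      obtain ⟨d, hd, hPd⟩ := Metric.continuousAt_iff.1 hc e he
      filter_upwards [Metric.ball_mem_nhds b hd] with b' hb'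
      rw [Metric.mem_ball, Real.dist_eq] at hb'
      have hc' : Continuous fun y => P (y, b') := by fun_prop
      have : (∫ y in b..b', P (y, b')) - (∫ y in b..b, P (y, b)) - (b' - b) • P (b, b)
          = ∫ y in b..b', (P (y, b') - P (b, b)) := by
        rw [intervalIntegral.integral_sub (hc'.intervalIntegrable _ _) intervalIntegrable_const]
        simp
      rw [this]
      refine intervalIntegral.norm_integral_le_of_norm_le_const fun y hy => ?_
      rw [← dist_eq_norm]
      refine (hPd ?_).le
      rw [Prod.dist_eq, Real.dist_eq, Real.dist_eq]
      refine max_lt (lt_of_le_of_lt (abs_sub_left_of_mem_uIcc (uIoc_subset_uIcc hy)) hb') hb'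
    simp only
    rw [hsplit]
    refine ((hD b).add (h1.sub h3)).congr_deriv ?_
    rw [h2]; ring

/-- Truncation of `r` to `[-L, L]`. -/
def truncate (L r : ℝ) : ℝ := max (-L) (min L r)

theorem continuous_truncate (L : ℝ) : Continuous (truncate L) := by unfold truncate; fun_prop

theorem abs_truncate_le {L : ℝ} (hL : 0 < L) (r : ℝ) : |truncate L r| ≤ L := by
  rw [abs_le]; unfold truncate
  exact ⟨le_max_left _ _, max_le (by linarith) (min_le_left _ _)⟩

theorem truncate_of_abs_le {L r : ℝ} (h : |r| ≤ L) : truncate L r = r := by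
  rw [abs_le] at h; unfold truncate
  rw [min_eq_right h.2, max_eq_right h.1]

/-- The primitive of `W` in its second variable that vanishes on the diagonal, truncated outside
the diagonal strip of width `L`. -/
noncomputable def sndPrimitive (L : ℝ) (W : ℝ × ℝ → ℝ) (z : ℝ × ℝ) : ℝ :=
  ∫ r in (0 : ℝ)..truncate L (z.2 - z.1), W (z.1, z.1 + r)

theorem continuous_sndPrimitive (L : ℝ) {W : ℝ × ℝ → ℝ} (hW : Continuous W) :
    Continuous (sndPrimitive L W) := by
  unfold sndPrimitive
  refine intervalIntegral.continuous_parametric_intervalIntegral_of_continuous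
    (f := fun (z : ℝ × ℝ) r => W (z.1, z.1 + r)) ?_ ?_
  · unfold Function.uncurry; fun_prop
  · exact (continuous_truncate L).comp (by fun_prop)

/-- The truncation serves this bound: valid on the whole plane, it lets the Goursat iteration run in
the bounded continuous functions on `ℝ × ℝ`. -/
theorem abs_sndPrimitive_le {L : ℝ} (hL : 0 < L) {W : ℝ × ℝ → ℝ} {M : ℝ} (hM : ∀ z, |W z| ≤ M)
    (z : ℝ × ℝ) : |sndPrimitive L W z| ≤ L * M := by
  have h := intervalIntegral.norm_integral_le_of_norm_le_const (a := 0)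
    (b := truncate L (z.2 - z.1)) (f := fun r => W (z.1, z.1 + r)) (C := M) (fun r _ => hM _)
  have h0 : 0 ≤ M := (abs_nonneg _).trans (hM z)
  rw [sub_zero, Real.norm_eq_abs] at h
  refine h.trans ?_
  rw [mul_comm]
  exact mul_le_mul_of_nonneg_right (abs_truncate_le hL _) h0

theorem sndPrimitive_sub (L : ℝ) {W W' : ℝ × ℝ → ℝ} (hW : Continuous W) (hW' : Continuous W')
    (z : ℝ × ℝ) :
    sndPrimitive L W z - sndPrimitive L W' z = sndPrimitive L (fun z => W z - W' z) z := by
  unfold sndPrimitive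
  rw [intervalIntegral.integral_sub]
  · exact (by fun_prop : Continuous fun r => W (z.1, z.1 + r)).intervalIntegrable _ _
  · exact (by fun_prop : Continuous fun r => W' (z.1, z.1 + r)).intervalIntegrable _ _

theorem hasDerivAt_sndPrimitive {L : ℝ} {W : ℝ × ℝ → ℝ} (hW : Continuous W)
    {z : ℝ × ℝ} (hz : z ∈ diagStrip L) :
    HasDerivAt (fun b => sndPrimitive L W (z.1, b)) (W z) z.2 := by
  obtain ⟨a, b⟩ := z
  have hc : Continuous fun r => W (a, a + r) := by fun_prop
  have h1 : HasDerivAt (fun s => ∫ r in (0 : ℝ)..s, W (a, a + r)) (W (a, a + (b - a))) (b - a) :=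
    intervalIntegral.integral_hasDerivAt_right (hc.intervalIntegrable _ _)
      hc.aestronglyMeasurable.stronglyMeasurableAtFilter hc.continuousAt
  have h2 : HasDerivAt (fun b => b - a) 1 b := (hasDerivAt_id b).sub_const a
  have h3 := HasDerivAt.comp b h1 h2
  rw [mul_one, add_sub_cancel] at h3
  refine h3.congr_of_eventuallyEq ?_
  have : {b' : ℝ | (a, b') ∈ diagStrip L} ∈ 𝓝 b :=
    ((isOpen_diagStrip L).preimage (by fun_prop : Continuous fun b' => (a, b'))).mem_nhds hz
  filter_upwards [this] with b' hb'
  have hb'' : |a - b'| < L := hb'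
  simp only [sndPrimitive, Function.comp_apply]
  rw [truncate_of_abs_le (by rw [abs_sub_comm]; exact hb''.le)]

theorem sndPrimitive_diag {L : ℝ} (hL : 0 < L) (W : ℝ × ℝ → ℝ) (a : ℝ) :
    sndPrimitive L W (a, a) = 0 := by
  simp [sndPrimitive, truncate, hL.le]

/-! ### Characteristic coordinates. -/

/-- Derivatives of time with respect to the two characteristic parameters: the linear Goursat
problem for a wave speed `Λ` that is close to `1` and varies slowly. -/
theorem exists_char_densities {Λ Λa Λb : ℝ × ℝ → ℝ} (hΛ : Continuous Λ) (hΛa : Continuous Λa)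
    (hΛb : Continuous Λb) {η L : ℝ} (hη : 0 < η) (hL : 0 < L) (hηL : η * L ≤ 1 / 100)
    (h1 : ∀ z, |Λ z - 1| ≤ 1 / 100) (hba : ∀ z, |Λa z| ≤ η) (hbb : ∀ z, |Λb z| ≤ η) :
    ∃ P Q W : ℝ × ℝ → ℝ, Continuous P ∧ Continuous Q ∧ Continuous W ∧ (∃ M, ∀ z, |W z| ≤ M) ∧
      (∀ z, |P z - 1 / 2| ≤ 1 / 50) ∧ (∀ z, |Q z + 1 / 2| ≤ 1 / 50) ∧
      (∀ z ∈ diagStrip L, HasDerivAt (fun b => P (z.1, b)) (W z) z.2) ∧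
      (∀ z ∈ diagStrip L, HasDerivAt (fun a => Q (a, z.2)) (W z) z.1) ∧
      (∀ a, P (a, a) = 1 / (2 * Λ (a, a))) ∧ (∀ a, Q (a, a) = -(1 / (2 * Λ (a, a)))) ∧
      ∀ z, 2 * Λ z * W z = -(Λa z * Q z + Λb z * P z) := by
  have hlo : ∀ z, 99 / 100 ≤ Λ z := fun z => by have := abs_le.1 (h1 z); linarith [this.1]
  have hpos : ∀ z, 0 < 2 * Λ z := fun z => by linarith [hlo z]
  have hinv : ∀ z, |1 / (2 * Λ z) - 1 / 2| ≤ 6 / 1000 := fun z => by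
    have e : 1 / (2 * Λ z) - 1 / 2 = (1 - Λ z) / (2 * Λ z) := by
      have : Λ z ≠ 0 := ne_of_gt (by linarith [hlo z])
      field_simp
    rw [e, abs_div, abs_of_pos (hpos z), div_le_iff₀ (hpos z), abs_sub_comm]
    linarith [h1 z, hlo z]
  -- Here `P = t_a`, `Q = t_b`, `W = t_ab`. Along characteristics `x_a = Λ t_a` and `x_b = -Λ t_b`;
  -- equality of the mixed derivatives of `x` is `2 Λ W = -(Λ_a Q + Λ_b P)`. On the diagonal `t = 0`
  -- and `x = a` force `t_a = -t_b = 1/(2Λ)`.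
  let PP : (ℝ × ℝ → ℝ) → ℝ × ℝ → ℝ := fun W z => 1 / (2 * Λ (z.1, z.1)) + sndPrimitive L W z
  let QQ : (ℝ × ℝ → ℝ) → ℝ × ℝ → ℝ := fun W z =>
    -(1 / (2 * Λ (z.2, z.2))) + sndPrimitive L (fun y => W y.swap) z.swap
  let F : (ℝ × ℝ → ℝ) → ℝ × ℝ → ℝ := fun W z => -(Λa z * QQ W z + Λb z * PP W z) / (2 * Λ z)
  have hne : ∀ z, 2 * Λ z ≠ 0 := fun z => (hpos z).ne'
  have cP : ∀ W, Continuous W → Continuous (PP W) := fun W hW => by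
    refine Continuous.add ?_ (continuous_sndPrimitive L hW)
    exact continuous_const.div (by fun_prop) fun z => hne _
  have cQ : ∀ W, Continuous W → Continuous (QQ W) := fun W hW => by
    refine Continuous.add (Continuous.neg ?_)
      ((continuous_sndPrimitive L (by fun_prop)).comp continuous_swap)
    exact continuous_const.div (by fun_prop) fun z => hne _
  have cF : ∀ W, Continuous W → Continuous (F W) := fun W hW => by
    have := cP W hW
    have := cQ W hW
    exact Continuous.div (by fun_prop) (by fun_prop) hne
  have bP : ∀ W M, (∀ z, |W z| ≤ M) → ∀ z, |PP W z - 1 / 2| ≤ 6 / 1000 + L * M := fun W M hM z => by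
    have := abs_sndPrimitive_le hL hM z
    have h2 := hinv (z.1, z.1)
    have e : PP W z - 1 / 2 = (1 / (2 * Λ (z.1, z.1)) - 1 / 2) + sndPrimitive L W z := by
      simp only [PP]; ring
    rw [e]
    exact (abs_add_le _ _).trans (by linarith)
  have bQ : ∀ W M, (∀ z, |W z| ≤ M) → ∀ z, |QQ W z + 1 / 2| ≤ 6 / 1000 + L * M := fun W M hM z => by
    have := abs_sndPrimitive_le hL (W := fun y => W y.swap) (fun z => hM z.swap) z.swap
    have h2 := hinv (z.2, z.2)
    have e : QQ W z + 1 / 2 = -(1 / (2 * Λ (z.2, z.2)) - 1 / 2) +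
        sndPrimitive L (fun y => W y.swap) z.swap := by
      simp only [QQ]; ring
    rw [e]
    refine (abs_add_le _ _).trans ?_
    rw [abs_neg]; linarith
  have comb : ∀ z p q B, |p| ≤ B → |q| ≤ B → |-(Λa z * q + Λb z * p) / (2 * Λ z)| ≤ 2 * η * B :=
    fun z p q B hp hq => by
      have hB : 0 ≤ B := (abs_nonneg _).trans hp
      rw [abs_div, abs_of_pos (hpos z), div_le_iff₀ (hpos z), abs_neg]
      have e1 : |Λa z * q| ≤ η * B := by
        rw [abs_mul]; exact mul_le_mul (hba z) hq (abs_nonneg _) hη.le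
      have e2 : |Λb z * p| ≤ η * B := by
        rw [abs_mul]; exact mul_le_mul (hbb z) hp (abs_nonneg _) hη.le
      have e3 : 0 ≤ η * B := by positivity
      have e4 := abs_add_le (Λa z * q) (Λb z * p)
      nlinarith [hlo z]
  have absP : ∀ W M, (∀ z, |W z| ≤ M) → ∀ z, |PP W z| ≤ 506 / 1000 + L * M := fun W M hM z => by
    have := abs_le.1 (bP W M hM z)
    rw [abs_le]; constructor <;> linarith [this.1, this.2]
  have absQ : ∀ W M, (∀ z, |W z| ≤ M) → ∀ z, |QQ W z| ≤ 506 / 1000 + L * M := fun W M hM z => by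
    have := abs_le.1 (bQ W M hM z)
    rw [abs_le]; constructor <;> linarith [this.1, this.2]
  let Φ : (ℝ × ℝ →ᵇ ℝ) → (ℝ × ℝ →ᵇ ℝ) := fun W =>
    BoundedContinuousFunction.ofNormedAddCommGroup (F W) (cF W W.continuous)
      (2 * η * (506 / 1000 + L * ‖W‖)) fun z =>
        comb z _ _ _ (absP W ‖W‖ W.norm_coe_le_norm z) (absQ W ‖W‖ W.norm_coe_le_norm z)
  -- The actual ratio is at most `2 η L ≤ 1/50`.
  have hΦ : ContractingWith (1 / 2) Φ := by
    refine ⟨by rw [div_lt_one] <;> norm_num, LipschitzWith.of_dist_le_mul fun W W' => ?_⟩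
    refine (BoundedContinuousFunction.dist_le (by positivity)).2 fun z => ?_
    have hWW : ∀ y, |W y - W' y| ≤ dist W W' := fun y => by
      rw [← Real.dist_eq]; exact BoundedContinuousFunction.dist_coe_le_dist y
    have eP : |PP W z - PP W' z| ≤ L * dist W W' := by
      have : PP W z - PP W' z = sndPrimitive L (fun z => W z - W' z) z := by
        rw [← sndPrimitive_sub L W.continuous W'.continuous]; simp only [PP]; ring
      rw [this]; exact abs_sndPrimitive_le hL hWW z
    have eQ : |QQ W z - QQ W' z| ≤ L * dist W W' := by
      have : QQ W z - QQ W' z = sndPrimitive L (fun z => W z.swap - W' z.swap) z.swap := by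
        rw [← sndPrimitive_sub L (W := fun y => W y.swap) (W' := fun y => W' y.swap)
          (by fun_prop) (by fun_prop)]
        simp only [QQ]; ring
      rw [this]; exact abs_sndPrimitive_le hL (fun y => hWW y.swap) z.swap
    have : Φ W z - Φ W' z =
        -(Λa z * (QQ W z - QQ W' z) + Λb z * (PP W z - PP W' z)) / (2 * Λ z) := by
      simp only [Φ, BoundedContinuousFunction.coe_ofNormedAddCommGroup, F]; ring
    rw [Real.dist_eq, this]
    refine (comb z _ _ _ eP eQ).trans ?_
    have h0 : 0 ≤ dist W W' := dist_nonneg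
    simp only [NNReal.coe_div, NNReal.coe_one, NNReal.coe_ofNat]
    nlinarith
  obtain ⟨W, hW⟩ : ∃ W, Φ W = W := ⟨_, hΦ.fixedPoint_isFixedPt⟩
  have hWF : ∀ z, W z = F W z := fun z => (DFunLike.congr_fun hW z).symm
  have hnorm : L * ‖W‖ ≤ 12 / 1000 := by
    have : ‖W‖ ≤ 2 * η * (506 / 1000 + L * ‖W‖) := by
      refine (BoundedContinuousFunction.norm_le (by positivity)).2 fun z => ?_
      rw [hWF z]
      exact comb z _ _ _ (absP W ‖W‖ W.norm_coe_le_norm z) (absQ W ‖W‖ W.norm_coe_le_norm z)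
    have h2 : L * ‖W‖ ≤ 2 * (η * L) * (506 / 1000 + L * ‖W‖) := by nlinarith
    have h3 : 0 ≤ L * ‖W‖ := by positivity
    nlinarith
  have hWc := W.continuous
  refine ⟨PP W, QQ W, W, cP W hWc, cQ W hWc, hWc, ⟨‖W‖, W.norm_coe_le_norm⟩,
    fun z => (bP W ‖W‖ W.norm_coe_le_norm z).trans (by linarith),
    fun z => (bQ W ‖W‖ W.norm_coe_le_norm z).trans (by linarith), ?_, ?_, ?_, ?_, ?_⟩
  · intro z hz
    exact (hasDerivAt_sndPrimitive hWc hz).const_add (1 / (2 * Λ (z.1, z.1)))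
  · intro z hz
    have hz' : z.swap ∈ diagStrip L := by
      have : |z.1 - z.2| < L := hz
      show |z.2 - z.1| < L
      rwa [abs_sub_comm]
    have := hasDerivAt_sndPrimitive (W := fun y => W y.swap) (by fun_prop) hz'
    simp only [Prod.swap_swap] at this
    exact this.const_add (-(1 / (2 * Λ (z.2, z.2))))
  · intro a; simp only [PP, sndPrimitive_diag hL, add_zero]
  · intro a; simp only [QQ, Prod.swap_prod_mk, sndPrimitive_diag hL, add_zero]
  · intro z
    conv_lhs => rw [hWF z]
    simp only [F]
    rw [mul_div_cancel₀ _ (hne z)]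

/-- Derivative of the inverse of a planar map, in coordinates. -/
theorem hasFDerivAt_planar_inverse {G g : ℝ × ℝ → ℝ × ℝ} {w : ℝ × ℝ}
    {A B C D A' B' C' D' : ℝ} (hg : ContinuousAt g w)
    (hG : HasFDerivAt G ((A • ContinuousLinearMap.fst ℝ ℝ ℝ + B • ContinuousLinearMap.snd ℝ ℝ ℝ).prod
      (C • ContinuousLinearMap.fst ℝ ℝ ℝ + D • ContinuousLinearMap.snd ℝ ℝ ℝ)) (g w))
    (hGg : ∀ᶠ y in 𝓝 w, G (g y) = y)
    (l11 : A' * A + B' * C = 1) (l12 : A' * B + B' * D = 0)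
    (l21 : C' * A + D' * C = 0) (l22 : C' * B + D' * D = 1)
    (r11 : A * A' + B * C' = 1) (r12 : A * B' + B * D' = 0)
    (r21 : C * A' + D * C' = 0) (r22 : C * B' + D * D' = 1) :
    HasFDerivAt g ((A' • ContinuousLinearMap.fst ℝ ℝ ℝ + B' • ContinuousLinearMap.snd ℝ ℝ ℝ).prod
      (C' • ContinuousLinearMap.fst ℝ ℝ ℝ + D' • ContinuousLinearMap.snd ℝ ℝ ℝ)) w := by
  let e : (ℝ × ℝ) ≃L[ℝ] (ℝ × ℝ) := ContinuousLinearEquiv.equivOfInverse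
    ((A • ContinuousLinearMap.fst ℝ ℝ ℝ + B • ContinuousLinearMap.snd ℝ ℝ ℝ).prod
      (C • ContinuousLinearMap.fst ℝ ℝ ℝ + D • ContinuousLinearMap.snd ℝ ℝ ℝ))
    ((A' • ContinuousLinearMap.fst ℝ ℝ ℝ + B' • ContinuousLinearMap.snd ℝ ℝ ℝ).prod
      (C' • ContinuousLinearMap.fst ℝ ℝ ℝ + D' • ContinuousLinearMap.snd ℝ ℝ ℝ))
    (fun z => by
      ext
      · simp; linear_combination z.1 * l11 + z.2 * l12
      · simp; linear_combination z.1 * l21 + z.2 * l22)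
    (fun z => by
      ext
      · simp; linear_combination z.1 * r11 + z.2 * r12
      · simp; linear_combination z.1 * r21 + z.2 * r22)
  exact HasFDerivAt.of_local_left_inverse (f' := e) hg hG hGg

/-- Lipschitz extension of a function with small derivative on the diagonal strip. -/
theorem exists_lipschitz_extension_strip {f p q : ℝ × ℝ → ℝ} {L : ℝ} {K : ℝ≥0}
    (hf : ∀ z ∈ diagStrip L, HasFDerivAt f
      (p z • ContinuousLinearMap.fst ℝ ℝ ℝ + q z • ContinuousLinearMap.snd ℝ ℝ ℝ) z)
    (hpq : ∀ z, |p z| + |q z| ≤ K) :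
    ∃ k : ℝ × ℝ → ℝ, LipschitzWith K k ∧ EqOn f k (diagStrip L) := by
  refine LipschitzOnWith.extend_real ((convex_diagStrip L).lipschitzOnWith_of_nnnorm_hasFDerivWithin_le
    (𝕜 := ℝ) (fun z hz => (hf z hz).hasFDerivWithinAt) fun z _ => ?_)
  rw [← NNReal.coe_le_coe, coe_nnnorm]
  refine (ContinuousLinearMap.opNorm_le_bound _ (by positivity) fun v => ?_)
  have h1 : |v.1| ≤ ‖v‖ := norm_fst_le v
  have h2 : |v.2| ≤ ‖v‖ := norm_snd_le v
  simp only [add_apply, smul_apply,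
    ContinuousLinearMap.coe_fst', ContinuousLinearMap.coe_snd', smul_eq_mul, Real.norm_eq_abs]
  calc |p z * v.1 + q z * v.2| ≤ |p z * v.1| + |q z * v.2| := abs_add_le _ _
    _ = |p z| * |v.1| + |q z| * |v.2| := by rw [abs_mul, abs_mul]
    _ ≤ |p z| * ‖v‖ + |q z| * ‖v‖ := by gcongr
    _ = (|p z| + |q z|) * ‖v‖ := by ring
    _ ≤ K * ‖v‖ := mul_le_mul_of_nonneg_right (hpq z) (norm_nonneg _)

/-- Characteristic coordinates `α`, `β` for a wave speed given as a function `Λ` of these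
coordinates: `α_t = Λ α_x`, `β_t = -Λ β_x`, `α = β = x` at `t = 0`. -/
theorem exists_char_coords {Λ Λa Λb : ℝ × ℝ → ℝ} (hΛ : Continuous Λ) (hΛa : Continuous Λa)
    (hΛb : Continuous Λb) (hda : ∀ z, HasDerivAt (fun a => Λ (a, z.2)) (Λa z) z.1)
    (hdb : ∀ z, HasDerivAt (fun b => Λ (z.1, b)) (Λb z) z.2)
    {η L : ℝ} (hη : 0 < η) (hL : 0 < L) (hηL : η * L ≤ 1 / 100)
    (h1 : ∀ z, |Λ z - 1| ≤ 1 / 100) (hba : ∀ z, |Λa z| ≤ η) (hbb : ∀ z, |Λb z| ≤ η) :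
    ∃ α β αx βx : ℝ × ℝ → ℝ, Continuous α ∧ Continuous β ∧ Continuous αx ∧ Continuous βx ∧
      (∀ z, |αx z| ≤ 2) ∧ (∀ z, |βx z| ≤ 2) ∧ (∀ x, α (0, x) = x) ∧ (∀ x, β (0, x) = x) ∧
      ∀ t x, |t| < L / 4 →
        HasDerivAt (fun y => α (t, y)) (αx (t, x)) x ∧
        HasDerivAt (fun y => β (t, y)) (βx (t, x)) x ∧
        HasDerivAt (fun s => α (s, x)) (Λ (α (t, x), β (t, x)) * αx (t, x)) t ∧
        HasDerivAt (fun s => β (s, x)) (-(Λ (α (t, x), β (t, x)) * βx (t, x))) t := by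
  obtain ⟨P, Q, W, hP, hQ, hW, ⟨M, hM⟩, bP, bQ, dP, dQ, eP, eQ, eW⟩ :=
    exists_char_densities hΛ hΛa hΛb hη hL hηL h1 hba hbb
  have rΛ : ∀ z, 99 / 100 ≤ Λ z ∧ Λ z ≤ 101 / 100 := fun z => by
    have := abs_le.1 (h1 z); constructor <;> linarith [this.1, this.2]
  have rP : ∀ z, 48 / 100 ≤ P z ∧ P z ≤ 52 / 100 := fun z => by
    have := abs_le.1 (bP z); constructor <;> linarith [this.1, this.2]
  have rQ : ∀ z, -(52 / 100) ≤ Q z ∧ Q z ≤ -(48 / 100) := fun z => by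
    have := abs_le.1 (bQ z); constructor <;> linarith [this.1, this.2]
  have bW : ∀ z, |Λb z * P z + (Λ z + 1) * W z| ≤ η + 3 * M := fun z => by
    have a1 : |P z| ≤ 1 := by rw [abs_le]; constructor <;> linarith [rP z]
    have a2 : |Λ z + 1| ≤ 3 := by rw [abs_le]; constructor <;> linarith [rΛ z]
    calc _ ≤ |Λb z| * |P z| + |Λ z + 1| * |W z| := by
          rw [← abs_mul, ← abs_mul]; exact abs_add_le _ _
      _ ≤ η * 1 + 3 * M := by gcongr <;> [exact hbb z; exact hM z]
      _ = _ := by ring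
  have bW' : ∀ z, |Λb z * P z + (Λ z - 1) * W z| ≤ η + 3 * M := fun z => by
    have a1 : |P z| ≤ 1 := by rw [abs_le]; constructor <;> linarith [rP z]
    have a2 : |Λ z - 1| ≤ 3 := (h1 z).trans (by norm_num)
    calc _ ≤ |Λb z| * |P z| + |Λ z - 1| * |W z| := by
          rw [← abs_mul, ← abs_mul]; exact abs_add_le _ _
      _ ≤ η * 1 + 3 * M := by gcongr <;> [exact hbb z; exact hM z]
      _ = _ := by ring
  have hΛpos : ∀ z, Λ z ≠ 0 := fun z => ne_of_gt (by linarith [rΛ z])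
  have hPpos : ∀ z, P z ≠ 0 := fun z => ne_of_gt (by linarith [rP z])
  have hQpos : ∀ z, Q z ≠ 0 := fun z => ne_of_lt (by linarith [rQ z])
  -- `g₁` and `g₂` are `x + t` and `x - t` as functions of `(a, b)`, from `dt = P da + Q db` and `dx
  -- = Λ P da - Λ Q db`. Closedness of both forms is the Goursat equation `eW`.
  obtain ⟨g₁, g₁d, hg₁⟩ := exists_potential_strip (P := fun z => (Λ z + 1) * P z)
    (Q := fun z => (1 - Λ z) * Q z) (W := fun z => Λb z * P z + (Λ z + 1) * W z) (L := L) (D := id)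
    (by fun_prop) (by fun_prop) (by fun_prop) bW
    (fun z hz => ((hdb z).add_const 1).mul (dP z hz))
    (fun z hz => (((hda z).const_sub 1).mul (dQ z hz)).congr_deriv (by linear_combination -eW z))
    (fun a => (hasDerivAt_id a).congr_deriv (by
      rw [eP, eQ]; have := hΛpos (a, a); field_simp; ring))
  obtain ⟨g₂, g₂d, hg₂⟩ := exists_potential_strip (P := fun z => (Λ z - 1) * P z)
    (Q := fun z => -((Λ z + 1) * Q z)) (W := fun z => Λb z * P z + (Λ z - 1) * W z) (L := L) (D := id)
    (by fun_prop) (by fun_prop) (by fun_prop) bW'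
    (fun z hz => ((hdb z).sub_const 1).mul (dP z hz))
    (fun z hz => (((hda z).add_const 1).mul (dQ z hz)).neg.congr_deriv (by linear_combination -eW z))
    (fun a => (hasDerivAt_id a).congr_deriv (by
      rw [eP, eQ]; have := hΛpos (a, a); field_simp; ring))
  -- On the strip `x + t` and `x - t` differ from `a` and `b` by `1/10`-Lipschitz functions.
  -- Extending these differences to the plane makes the characteristic map a small perturbation of
  -- the identity, hence a global homeomorphism.
  obtain ⟨k₁, hk₁, ek₁⟩ := exists_lipschitz_extension_strip (L := L) (f := fun z => g₁ z - z.1)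
    (p := fun z => (Λ z + 1) * P z - 1) (q := fun z => (1 - Λ z) * Q z) (K := 1 / 10)
    (fun z hz => by
      refine ((hg₁ z hz).hasFDerivAt.sub hasFDerivAt_fst).congr_fderiv ?_
      ext <;> simp)
    (fun z => by
      have b1 : |(Λ z + 1) * P z - 1| ≤ 5 / 100 := by
        rw [abs_le]; constructor <;> nlinarith [rΛ z, rP z]
      have b2 : |(1 - Λ z) * Q z| ≤ 1 / 100 := by
        rw [abs_mul, abs_sub_comm]
        have : |Q z| ≤ 1 := by rw [abs_le]; constructor <;> linarith [rQ z]
        nlinarith [h1 z, abs_nonneg (Q z), abs_nonneg (Λ z - 1)]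
      push_cast; linarith)
  obtain ⟨k₂, hk₂, ek₂⟩ := exists_lipschitz_extension_strip (L := L) (f := fun z => g₂ z - z.2)
    (p := fun z => (Λ z - 1) * P z) (q := fun z => -((Λ z + 1) * Q z) - 1) (K := 1 / 10)
    (fun z hz => by
      refine ((hg₂ z hz).hasFDerivAt.sub hasFDerivAt_snd).congr_fderiv ?_
      ext <;> simp)
    (fun z => by
      have b1 : |-((Λ z + 1) * Q z) - 1| ≤ 5 / 100 := by
        rw [abs_le]; constructor <;> nlinarith [rΛ z, rQ z]
      have b2 : |(Λ z - 1) * P z| ≤ 1 / 100 := by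
        rw [abs_mul]
        have : |P z| ≤ 1 := by rw [abs_le]; constructor <;> linarith [rP z]
        nlinarith [h1 z, abs_nonneg (P z), abs_nonneg (Λ z - 1)]
      push_cast; linarith)
  -- the characteristic map and its inverse
  let G : ℝ × ℝ → ℝ × ℝ := fun z => (z.1 + k₁ z, z.2 + k₂ z)
  have hGapp : ApproximatesLinearOn G
      ((ContinuousLinearEquiv.refl ℝ (ℝ × ℝ) : (ℝ × ℝ) ≃L[ℝ] (ℝ × ℝ)) : (ℝ × ℝ) →L[ℝ] (ℝ × ℝ))
      univ (1 / 10) := by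
    intro y _ z _
    have e : G y - G z - (ContinuousLinearEquiv.refl ℝ (ℝ × ℝ) : (ℝ × ℝ) →L[ℝ] (ℝ × ℝ)) (y - z)
        = (k₁ y - k₁ z, k₂ y - k₂ z) := by
      ext <;> simp [G] <;> ring
    rw [e, Prod.norm_def]
    refine max_le ?_ ?_
    · simpa [dist_eq_norm] using hk₁.dist_le_mul y z
    · simpa [dist_eq_norm] using hk₂.dist_le_mul y z
  let H : (ℝ × ℝ) ≃ₜ (ℝ × ℝ) := hGapp.toHomeomorph G (Or.inr (by
    have : ‖((ContinuousLinearEquiv.refl ℝ (ℝ × ℝ)).symm : (ℝ × ℝ) →L[ℝ] (ℝ × ℝ))‖₊ = 1 := by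
      rw [← NNReal.coe_inj, coe_nnnorm]
      exact ContinuousLinearMap.norm_id
    rw [this, inv_one, div_lt_one] <;> norm_num))
  have hGH : ∀ w, G (H.symm w) = w := fun w => H.apply_symm_apply w
  have hHG : ∀ z, H.symm (G z) = z := fun z => H.symm_apply_apply z
  have hdiag : ∀ m, (m, m) ∈ diagStrip L := fun m => by simp [diagStrip, hL]
  have k₁d : ∀ m, k₁ (m, m) = 0 := fun m => by rw [← ek₁ (hdiag m)]; simp [g₁d]
  have k₂d : ∀ m, k₂ (m, m) = 0 := fun m => by rw [← ek₂ (hdiag m)]; simp [g₂d]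
  have hGd : ∀ m, G (m, m) = (m, m) := fun m => by simp [G, k₁d, k₂d]
  let γ : ℝ × ℝ → ℝ × ℝ := fun p => H.symm (p.2 + p.1, p.2 - p.1)
  have cγ : Continuous γ := H.symm.continuous.comp (by fun_prop)
  -- `k₁` and `k₂` vanish on the diagonal and `(a, b)` is within `|a - b| / 2` of it, so each is at
  -- most `|a - b| / 20`; then `|a - b| ≤ 2 |t| + |a - b| / 10`.
  have hstrip : ∀ t x, |t| < L / 4 → γ (t, x) ∈ diagStrip L := by
    intro t x ht
    have hG' : G (γ (t, x)) = (x + t, x - t) := hGH _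
    generalize γ (t, x) = z at hG'
    obtain ⟨a, b⟩ := z
    have hdist : dist (a, b) ((a + b) / 2, (a + b) / 2) ≤ |a - b| / 2 := by
      rw [Prod.dist_eq]
      refine max_le ?_ ?_ <;> simp only [Real.dist_eq]
      · rw [show a - (a + b) / 2 = (a - b) / 2 by ring, abs_div, abs_two]
      · rw [show b - (a + b) / 2 = -((a - b) / 2) by ring, abs_neg, abs_div, abs_two]
    have d1 := hk₁.dist_le_mul (a, b) ((a + b) / 2, (a + b) / 2)
    have d2 := hk₂.dist_le_mul (a, b) ((a + b) / 2, (a + b) / 2)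
    rw [k₁d, Real.dist_eq, sub_zero] at d1
    rw [k₂d, Real.dist_eq, sub_zero] at d2
    push_cast at d1 d2
    have g1 : a + k₁ (a, b) = x + t := congrArg Prod.fst hG'
    have g2 : b + k₂ (a, b) = x - t := congrArg Prod.snd hG'
    show |a - b| < L
    have : a - b = 2 * t - k₁ (a, b) + k₂ (a, b) := by linarith
    have tri : |a - b| ≤ 2 * |t| + |k₁ (a, b)| + |k₂ (a, b)| := by
      rw [this]
      refine (abs_add_le _ _).trans (add_le_add_left ((abs_sub _ _).trans ?_) _)
      rw [abs_mul, abs_two]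
    linarith [abs_nonneg t]
  have hder : ∀ t x, |t| < L / 4 → HasFDerivAt H.symm
      ((((1 + 1 / Λ (γ (t, x))) / (4 * P (γ (t, x)))) • ContinuousLinearMap.fst ℝ ℝ ℝ +
        ((1 / Λ (γ (t, x)) - 1) / (4 * P (γ (t, x)))) • ContinuousLinearMap.snd ℝ ℝ ℝ).prod
      (((1 - 1 / Λ (γ (t, x))) / (4 * Q (γ (t, x)))) • ContinuousLinearMap.fst ℝ ℝ ℝ +
        ((-1 - 1 / Λ (γ (t, x))) / (4 * Q (γ (t, x)))) • ContinuousLinearMap.snd ℝ ℝ ℝ))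
      (x + t, x - t) := by
    intro t x ht
    have hz := hstrip t x ht
    have hz' : H.symm (x + t, x - t) = γ (t, x) := rfl
    generalize γ (t, x) = z at hz hz'
    have n1 := hΛpos z
    have n2 := hPpos z
    have n3 := hQpos z
    refine hasFDerivAt_planar_inverse (G := G) (A := (Λ z + 1) * P z) (B := (1 - Λ z) * Q z)
      (C := (Λ z - 1) * P z) (D := -((Λ z + 1) * Q z)) H.symm.continuous.continuousAt ?_
      (Eventually.of_forall hGH) ?_ ?_ ?_ ?_ ?_ ?_ ?_ ?_
    · rw [hz']
      refine ((hg₁ z hz).hasFDerivAt.prodMk (hg₂ z hz).hasFDerivAt).congr_of_eventuallyEq ?_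
      filter_upwards [(isOpen_diagStrip L).mem_nhds hz] with y hy
      ext
      · simp [G, ← ek₁ hy]
      · simp [G, ← ek₂ hy]
    all_goals field_simp; ring
  refine ⟨fun p => (γ p).1, fun p => (γ p).2, fun p => 1 / (2 * Λ (γ p) * P (γ p)),
    fun p => -(1 / (2 * Λ (γ p) * Q (γ p))), by fun_prop, by fun_prop, ?_, ?_, ?_, ?_, ?_, ?_, ?_⟩
  · exact continuous_const.div (by fun_prop) fun p => mul_ne_zero (mul_ne_zero two_ne_zero (hΛpos _)) (hPpos _)
  · exact (continuous_const.div (by fun_prop) fun p =>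
      mul_ne_zero (mul_ne_zero two_ne_zero (hΛpos _)) (hQpos _)).neg
  · intro p
    have : 1 / 2 ≤ 2 * Λ (γ p) * P (γ p) := by nlinarith [rΛ (γ p), rP (γ p)]
    rw [abs_div, abs_one, abs_of_pos (by linarith), div_le_iff₀ (by linarith)]
    linarith
  · intro p
    have : 2 * Λ (γ p) * Q (γ p) ≤ -(1 / 2) := by nlinarith [rΛ (γ p), rQ (γ p)]
    rw [abs_neg, abs_div, abs_one, abs_of_neg (by linarith), div_le_iff₀ (by linarith)]
    linarith
  · intro x
    have : γ (0, x) = (x, x) := by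
      have := hHG (x, x)
      rw [hGd] at this
      simpa [γ] using this
    simp only [this]
  · intro x
    have : γ (0, x) = (x, x) := by
      have := hHG (x, x)
      rw [hGd] at this
      simpa [γ] using this
    simp only [this]
  · intro t x ht
    have hd := hder t x ht
    have lx : HasDerivAt (fun y => ((y + t, y - t) : ℝ × ℝ)) (1, 1) x :=
      ((hasDerivAt_id x).add_const t).prodMk ((hasDerivAt_id x).sub_const t)
    have lt : HasDerivAt (fun s => ((x + s, x - s) : ℝ × ℝ)) (1, -1) t :=
      ((hasDerivAt_id t).const_add x).prodMk ((hasDerivAt_id t).const_sub x)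
    have dx := hd.comp_hasDerivAt x lx
    have dt := hd.comp_hasDerivAt t lt
    have n1 := hΛpos (γ (t, x))
    have n2 := hPpos (γ (t, x))
    have n3 := hQpos (γ (t, x))
    refine ⟨(hasFDerivAt_fst.comp_hasDerivAt x dx).congr_deriv ?_,
      (hasFDerivAt_snd.comp_hasDerivAt x dx).congr_deriv ?_,
      (hasFDerivAt_fst.comp_hasDerivAt t dt).congr_deriv ?_,
      (hasFDerivAt_snd.comp_hasDerivAt t dt).congr_deriv ?_⟩ <;>
    · simp only [ContinuousLinearMap.prod_apply, ContinuousLinearMap.coe_fst',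
        ContinuousLinearMap.coe_snd', add_apply,
        smul_apply, smul_eq_mul, Prod.mk.eta]
      field_simp
      ring

/-! ### Classical solutions for a slowly varying speed. -/

/-- A primitive of a function close to `1`, together with its inverse. -/
theorem exists_primitive_inverse {k : ℝ → ℝ} (hk : Continuous k) (k1 : ∀ θ, |k θ - 1| ≤ 1 / 100) :
    ∃ F V : ℝ → ℝ, (∀ θ, HasDerivAt F (k θ) θ) ∧ (∀ z, HasDerivAt V (k (V z))⁻¹ z) ∧
      (∀ θ, V (F θ) = θ) ∧ (∀ θ, |F θ| ≤ 101 / 100 * |θ|) ∧ (∀ z, |V z| ≤ 102 / 100 * |z|) := by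
  have rk : ∀ z, 99 / 100 ≤ k z ∧ k z ≤ 101 / 100 := fun z => by
    have := abs_le.1 (k1 z); constructor <;> linarith [this.1, this.2]
  let F : ℝ → ℝ := fun θ => ∫ y in (0 : ℝ)..θ, k y
  have hF : ∀ θ, HasDerivAt F (k θ) θ := fun θ =>
    intervalIntegral.integral_hasDerivAt_right (hk.intervalIntegrable _ _)
      hk.aestronglyMeasurable.stronglyMeasurableAtFilter hk.continuousAt
  have cF : Continuous F := continuous_iff_continuousAt.2 fun θ => (hF θ).continuousAt
  have hF1 : ∀ θ, |F θ - θ| ≤ 1 / 100 * |θ| := fun θ => by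
    have e : F θ - θ = ∫ y in (0 : ℝ)..θ, (k y - 1) := by
      rw [intervalIntegral.integral_sub (hk.intervalIntegrable _ _) intervalIntegrable_const]
      simp [F]
    have := intervalIntegral.norm_integral_le_of_norm_le_const (a := 0) (b := θ)
      (f := fun y => k y - 1) (C := 1 / 100) (fun y _ => k1 y)
    rw [e]; simpa using this
  have mF : StrictMono F := strictMono_of_hasDerivAt_pos hF fun θ => by linarith [rk θ]
  have sF : Function.Surjective F := by
    refine cF.surjective ?_ ?_
    · refine tendsto_atTop_mono' atTop (f₁ := fun θ => θ / 2) ?_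
        ((tendsto_id (α := ℝ)).atTop_div_const two_pos)
      filter_upwards [eventually_ge_atTop 0] with θ hθ
      have := abs_le.1 (hF1 θ)
      rw [abs_of_nonneg hθ] at this
      linarith [this.1]
    · refine tendsto_atBot_mono' atBot (f₁ := fun θ => θ / 2) ?_
        ((tendsto_id (α := ℝ)).atBot_div_const two_pos)
      filter_upwards [eventually_le_atBot 0] with θ hθ
      have := abs_le.1 (hF1 θ)
      rw [abs_of_nonpos hθ] at this
      linarith [this.2]
  let e := (mF.orderIsoOfSurjective F sF).toHomeomorph
  have eF : ∀ z, F (e.symm z) = z := fun z => e.apply_symm_apply z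
  refine ⟨F, e.symm, hF, fun z => ?_, fun θ => e.symm_apply_apply θ, fun θ => ?_, fun z => ?_⟩
  · exact HasDerivAt.of_local_left_inverse e.symm.continuous.continuousAt (hF _)
      (ne_of_gt (by linarith [rk (e.symm z)]))
      (Eventually.of_forall eF)
  · have h := abs_add_le (F θ - θ) θ
    rw [sub_add_cancel] at h
    linarith [hF1 θ]
  · have h := abs_sub (F (e.symm z)) (F (e.symm z) - e.symm z)
    rw [sub_sub_cancel] at h
    have h2 := hF1 (e.symm z)
    rw [eF] at h h2
    linarith [abs_nonneg z]

/-- Existence of a classical solution up to a time inversely proportional to the size of the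
derivative of the wave speed. -/
theorem hasBoundedSolution_of_slow_speed {k k' : ℝ → ℝ} (hk : ∀ θ, HasDerivAt k (k' θ) θ)
    (ck' : Continuous k') (k1 : ∀ θ, |k θ - 1| ≤ 1 / 100) {f f' f'' g g' : ℝ → ℝ}
    (hf : ∀ x, HasDerivAt f (f' x) x) (hf' : ∀ x, HasDerivAt f' (f'' x) x)
    (hg : ∀ x, HasDerivAt g (g' x) x) (cf'' : Continuous f'') (cg' : Continuous g')
    {B m : ℝ} (hm : m ≤ 1 / 4) (bf : ∀ x, |f x| ≤ B) (bf' : ∀ x, |f' x| ≤ m)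
    (bf'' : ∀ x, |f'' x| ≤ m) (bg : ∀ x, |g x| ≤ m) (bg' : ∀ x, |g' x| ≤ m)
    {η L : ℝ} (hη : 0 < η) (hL : 0 < L) (hηL : η * L ≤ 1 / 100)
    (hk' : ∀ θ, |θ| ≤ 4 * m → |k' θ| ≤ η) {c : ℝ → ℝ} {U : Set ℝ}
    (hU : ∀ θ, |θ| ≤ 4 * m → θ ∈ U ∧ c θ = k θ) :
    HasBoundedSolution c U f g (L / 4) := by
  have ck : Continuous k := continuous_iff_continuousAt.2 fun θ => (hk θ).continuousAt
  have cf' : Continuous f' := continuous_iff_continuousAt.2 fun θ => (hf' θ).continuousAt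
  have cf : Continuous f := continuous_iff_continuousAt.2 fun θ => (hf θ).continuousAt
  have cg : Continuous g := continuous_iff_continuousAt.2 fun θ => (hg θ).continuousAt
  have m0 : 0 ≤ m := (abs_nonneg _).trans (bg 0)
  have rk : ∀ z, 99 / 100 ≤ k z ∧ k z ≤ 101 / 100 := fun z => by
    have := abs_le.1 (k1 z); constructor <;> linarith [this.1, this.2]
  have nk : ∀ z, k z ≠ 0 := fun z => ne_of_gt (by linarith [rk z])
  have ak : ∀ z, |k z| ≤ 101 / 100 := fun z => by rw [abs_of_pos (by linarith [rk z])]; exact (rk z).2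
  have aki : ∀ z, |(k z)⁻¹| ≤ 102 / 100 := fun z => by
    rw [abs_inv, abs_of_pos (by linarith [rk z])]
    exact inv_le_of_inv_le₀ (by norm_num) (by norm_num; linarith [rk z])
  obtain ⟨F, V, hF, hV, hVF, bF, bV⟩ := exists_primitive_inverse ck k1
  have cF : Continuous F := continuous_iff_continuousAt.2 fun θ => (hF θ).continuousAt
  have cV : Continuous V := continuous_iff_continuousAt.2 fun θ => (hV θ).continuousAt
  -- Riemann invariants of the data
  let S : ℝ → ℝ := fun x => g x + F (f' x)
  let R : ℝ → ℝ := fun x => g x - F (f' x)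
  let S' : ℝ → ℝ := fun x => g' x + k (f' x) * f'' x
  let R' : ℝ → ℝ := fun x => g' x - k (f' x) * f'' x
  have hS : ∀ x, HasDerivAt S (S' x) x := fun x => (hg x).add ((hF _).comp x (hf' x))
  have hR : ∀ x, HasDerivAt R (R' x) x := fun x => (hg x).sub ((hF _).comp x (hf' x))
  have cS : Continuous S := by fun_prop
  have cR : Continuous R := by fun_prop
  have cS' : Continuous S' := by fun_prop
  have cR' : Continuous R' := by fun_prop
  have bkf : ∀ x, |k (f' x) * f'' x| ≤ 101 / 100 * m := fun x => by
    rw [abs_mul]; exact mul_le_mul (ak _) (bf'' x) (abs_nonneg _) (by norm_num)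
  have bFf : ∀ x, |F (f' x)| ≤ 101 / 100 * m := fun x => (bF _).trans (by linarith [bf' x])
  have bS : ∀ x, |S x| ≤ 201 / 100 * m := fun x =>
    (abs_add_le _ _).trans (by linarith [bg x, bFf x])
  have bR : ∀ x, |R x| ≤ 201 / 100 * m := fun x =>
    (abs_sub _ _).trans (by linarith [bg x, bFf x])
  have bS' : ∀ x, |S' x| ≤ 1 := fun x =>
    (abs_add_le _ _).trans (by linarith [bg' x, bkf x])
  have bR' : ∀ x, |R' x| ≤ 1 := fun x =>
    (abs_sub _ _).trans (by linarith [bg' x, bkf x])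
  -- Since `S` depends on `α` only and `R` on `β` only, `v` is known as a function of `(α, β)`
  -- before the coordinates are constructed. This removes the nonlinearity.
  let Vv : ℝ × ℝ → ℝ := fun z => V ((S z.1 - R z.2) / 2)
  have cVv : Continuous Vv := by fun_prop
  have bVv : ∀ z, |Vv z| ≤ 4 * m := fun z => by
    refine (bV _).trans ?_
    rw [abs_div, abs_two]
    linarith [abs_sub (S z.1) (R z.2), bS z.1, bR z.2]
  have hVa : ∀ z, HasDerivAt (fun a => Vv (a, z.2)) ((k (Vv z))⁻¹ * (S' z.1 / 2)) z.1 := fun z =>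
    (hV _).comp z.1 (((hS z.1).sub_const (R z.2)).div_const 2)
  have hVb : ∀ z, HasDerivAt (fun b => Vv (z.1, b)) ((k (Vv z))⁻¹ * (-R' z.2 / 2)) z.2 := fun z =>
    (hV _).comp z.2 (((hR z.2).const_sub (S z.1)).div_const 2)
  have cinv : Continuous fun z => (k (Vv z))⁻¹ := (ck.comp cVv).inv₀ fun z => nk _
  have slow : ∀ z s, |s| ≤ 1 → |k' (Vv z) * ((k (Vv z))⁻¹ * (s / 2))| ≤ η := fun z s hs => by
    rw [abs_mul]
    have : |(k (Vv z))⁻¹ * (s / 2)| ≤ 1 := by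
      rw [abs_mul, abs_div, abs_two]
      have := aki (Vv z)
      nlinarith [abs_nonneg s, abs_nonneg (k (Vv z))⁻¹]
    have h2 := hk' _ (bVv z)
    nlinarith [abs_nonneg (k' (Vv z))]
  obtain ⟨α, β, αx, βx, cα, cβ, cαx, cβx, bαx, bβx, α0, β0, hαβ⟩ :=
    exists_char_coords (Λ := fun z => k (Vv z))
      (Λa := fun z => k' (Vv z) * ((k (Vv z))⁻¹ * (S' z.1 / 2)))
      (Λb := fun z => k' (Vv z) * ((k (Vv z))⁻¹ * (-R' z.2 / 2)))
      (by fun_prop) (by fun_prop) (by fun_prop) (fun z => (hk _).comp z.1 (hVa z))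
      (fun z => (hk _).comp z.2 (hVb z)) hη hL hηL (fun z => k1 _)
      (fun z => slow z _ (bS' _)) (fun z => slow z _ (by rw [abs_neg]; exact bR' _))
  let v : ℝ × ℝ → ℝ := fun p => Vv (α p, β p)
  let w : ℝ × ℝ → ℝ := fun p => (S (α p) + R (β p)) / 2
  let Sx : ℝ × ℝ → ℝ := fun p => S' (α p) * αx p
  let Rx : ℝ × ℝ → ℝ := fun p => R' (β p) * βx p
  have cv : Continuous v := by fun_prop
  have cw : Continuous w := by fun_prop
  have cSx : Continuous Sx := by fun_prop
  have cRx : Continuous Rx := by fun_prop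
  have ckv : Continuous fun p => (k (v p))⁻¹ := (ck.comp cv).inv₀ fun z => nk _
  have bSx : ∀ p, |Sx p| ≤ 2 := fun p => by
    rw [abs_mul]; nlinarith [bS' (α p), bαx p, abs_nonneg (S' (α p)), abs_nonneg (αx p)]
  have bRx : ∀ p, |Rx p| ≤ 2 := fun p => by
    rw [abs_mul]; nlinarith [bR' (β p), bβx p, abs_nonneg (R' (β p)), abs_nonneg (βx p)]
  have bsum : ∀ p, |(Sx p + Rx p) / 2| ≤ 2 := fun p => by
    rw [abs_div, abs_two]; linarith [abs_add_le (Sx p) (Rx p), bSx p, bRx p]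
  have bdiff : ∀ p, |(Sx p - Rx p) / 2| ≤ 2 := fun p => by
    rw [abs_div, abs_two]; linarith [abs_sub (Sx p) (Rx p), bSx p, bRx p]
  have bv : ∀ p, |v p| ≤ 4 * m := fun p => bVv _
  have bw : ∀ p, |w p| ≤ 1 := fun p => by
    rw [abs_div, abs_two]
    linarith [abs_add_le (S (α p)) (R (β p)), bS (α p), bR (β p)]
  have dw : ∀ t x, |t| < L / 4 → HasDerivAt (fun y => w (t, y)) ((Sx (t, x) + Rx (t, x)) / 2) x :=
    fun t x ht => by
      obtain ⟨h1, h2, -, -⟩ := hαβ t x ht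
      exact (((hS _).comp x h1).add ((hR _).comp x h2)).div_const 2
  have dwt : ∀ t x, |t| < L / 4 →
      HasDerivAt (fun s => w (s, x)) (k (v (t, x)) * ((Sx (t, x) - Rx (t, x)) / 2)) t :=
    fun t x ht => by
      obtain ⟨-, -, h1, h2⟩ := hαβ t x ht
      refine ((((hS _).comp t h1).add ((hR _).comp t h2)).div_const 2).congr_deriv ?_
      simp only [Sx, Rx, v]; ring
  have dv : ∀ t x, |t| < L / 4 →
      HasDerivAt (fun y => v (t, y)) ((k (v (t, x)))⁻¹ * ((Sx (t, x) - Rx (t, x)) / 2)) x :=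
    fun t x ht => by
      obtain ⟨h1, h2, -, -⟩ := hαβ t x ht
      exact (hV _).comp x ((((hS _).comp x h1).sub ((hR _).comp x h2)).div_const 2)
  have dvt : ∀ t x, |t| < L / 4 →
      HasDerivAt (fun s => v (s, x)) ((Sx (t, x) + Rx (t, x)) / 2) t :=
    fun t x ht => by
      obtain ⟨-, -, h1, h2⟩ := hαβ t x ht
      refine ((hV _).comp t ((((hS _).comp t h1).sub ((hR _).comp t h2)).div_const 2)).congr_deriv ?_
      simp only [Sx, Rx]
      change (k (Vv (α (t, x), β (t, x))))⁻¹ * _ = _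
      have := nk (Vv (α (t, x), β (t, x)))
      field_simp; ring
  have v0 : ∀ x, v (0, x) = f' x := fun x => by
    simp only [v, Vv, α0, β0, S, R]
    rw [show (g x + F (f' x) - (g x - F (f' x))) / 2 = F (f' x) by ring, hVF]
  -- With `u` the time integral of `w`, the identity `u_x = v` comes from `w_x = v_t` and `v (0, x)
  -- = f' x`.
  let u : ℝ × ℝ → ℝ := fun p => f p.2 + ∫ r in (0 : ℝ)..p.1, w (r, p.2)
  have cu : Continuous u := by
    refine Continuous.add (by fun_prop) ?_
    exact intervalIntegral.continuous_parametric_intervalIntegral_of_continuous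
      (f := fun (p : ℝ × ℝ) r => w (r, p.2)) (by unfold Function.uncurry; fun_prop) continuous_fst
  have dut : ∀ t x, HasDerivAt (fun s => u (s, x)) (w (t, x)) t := fun t x => by
    have hc : Continuous fun r => w (r, x) := by fun_prop
    exact (intervalIntegral.integral_hasDerivAt_right (hc.intervalIntegrable _ _)
      hc.aestronglyMeasurable.stronglyMeasurableAtFilter hc.continuousAt).const_add (f x)
  have inside : ∀ t ∈ Ico 0 (L / 4), |t| < L / 4 := fun t ht => by
    rw [abs_of_nonneg ht.1]; exact ht.2
  have dux : ∀ t ∈ Ico 0 (L / 4), ∀ x, HasDerivAt (fun y => u (t, y)) (v (t, x)) x := by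
    intro t ht x
    have hr : ∀ r ∈ uIcc 0 t, |r| < L / 4 := fun r hr => by
      rw [uIcc_of_le ht.1] at hr
      rw [abs_of_nonneg hr.1]; exact hr.2.trans_lt ht.2
    have h1 := hasDerivAt_intervalIntegral_param (P := w) (W := fun p => (Sx p + Rx p) / 2)
      cw (by fun_prop) bsum (a₀ := 0) (a₁ := t) (b₀ := x) one_pos
      (fun r hr' y _ => dw r y (hr r hr'))
    have h2 : ∫ r in (0 : ℝ)..t, (Sx (r, x) + Rx (r, x)) / 2 = v (t, x) - v (0, x) :=
      intervalIntegral.integral_eq_sub_of_hasDerivAt (f := fun r => v (r, x))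
        (fun r hr' => dvt r x (hr r hr'))
        ((by fun_prop : Continuous fun r => (Sx (r, x) + Rx (r, x)) / 2).intervalIntegrable _ _)
    refine ((hf x).add h1).congr_deriv ?_
    rw [h2, v0]; ring
  refine ⟨fun t x => u (t, x), fun t x => w (t, x), fun t x => v (t, x),
    fun t x => k (v (t, x)) * ((Sx (t, x) - Rx (t, x)) / 2),
    fun t x => (Sx (t, x) + Rx (t, x)) / 2,
    fun t x => (k (v (t, x)))⁻¹ * ((Sx (t, x) - Rx (t, x)) / 2),
    { cont_u := cu.continuousOn
      cont_ut := cw.continuousOn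
      cont_ux := cv.continuousOn
      cont_utt := Continuous.continuousOn (by fun_prop)
      cont_utx := Continuous.continuousOn (by fun_prop)
      cont_uxx := (ckv.mul (by fun_prop : Continuous fun p => (Sx p - Rx p) / 2)).continuousOn
      deriv_t := fun t _ x => (dut t x).hasDerivWithinAt
      deriv_x := dux
      deriv_tt := fun t ht x => (dwt t x (inside t ht)).hasDerivWithinAt
      deriv_tx := fun t ht x => dw t x (inside t ht)
      deriv_xt := fun t ht x => (dvt t x (inside t ht)).hasDerivWithinAt
      deriv_xx := fun t ht x => dv t x (inside t ht)
      mem_domain := fun t _ x => (hU _ (bv _)).1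
      equation := fun t _ x => ?_
      initial_u := fun x => by simp [u]
      initial_ut := fun x => ?_ }, B + L + 3, ?_⟩
  · rw [(hU _ (bv (t, x))).2]
    have := nk (v (t, x))
    field_simp; ring
  · simp only [w, α0, β0, S, R]; ring
  · intro t ht x
    have B0 : 0 ≤ B := (abs_nonneg _).trans (bf 0)
    have hint : |∫ r in (0 : ℝ)..t, w (r, x)| ≤ L := by
      have h := intervalIntegral.norm_integral_le_of_norm_le_const (a := 0) (b := t)
        (f := fun r => w (r, x)) (C := 1) (fun r _ => bw _)
      rw [sub_zero, Real.norm_eq_abs] at h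
      linarith [inside t ht]
    refine ⟨(abs_add_le _ _).trans (by linarith [bf x]), by linarith [bw (t, x)],
      by linarith [bv (t, x)], ?_, by linarith [bsum (t, x)], ?_, ?_, ?_⟩
    · rw [abs_mul]
      nlinarith [ak (v (t, x)), bdiff (t, x), abs_nonneg (k (v (t, x))),
        abs_nonneg ((Sx (t, x) - Rx (t, x)) / 2)]
    · rw [abs_mul]
      nlinarith [aki (v (t, x)), bdiff (t, x), abs_nonneg (k (v (t, x)))⁻¹,
        abs_nonneg ((Sx (t, x) - Rx (t, x)) / 2)]
    · rw [(hU _ (bv (t, x))).2]; exact nk _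
    · rw [(hU _ (bv (t, x))).2]; linarith [aki (v (t, x))]

/-! ### Flat Gevrey functions and the lower bound. -/

theorem hasDerivAt_iteratedDeriv_of_contDiffOn {c : ℝ → ℝ} {U : Set ℝ} (hU : IsOpen U)
    (hc : ContDiffOn ℝ ∞ c U) (m : ℕ) {θ : ℝ} (hθ : θ ∈ U) :
    HasDerivAt (iteratedDeriv m c) (iteratedDeriv (m + 1) c θ) θ := by
  have h1 := hc.differentiableOn_iteratedDerivWithin (m := m)
    (by exact_mod_cast ENat.natCast_lt_top m) hU.uniqueDiffOn
  have h2 : DifferentiableAt ℝ (iteratedDeriv m c) θ :=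
    ((h1 θ hθ).differentiableAt (hU.mem_nhds hθ)).congr_of_eventuallyEq
      ((iteratedDerivWithin_of_isOpen hU).symm.eventuallyEq_of_mem (hU.mem_nhds hθ))
  rw [iteratedDeriv_succ]
  exact h2.hasDerivAt

/-- Taylor bound for a sequence of successive derivatives vanishing at `0`. -/
theorem abs_le_taylor_of_flat {F : ℕ → ℝ → ℝ} {δ : ℝ}
    (hd : ∀ m θ, |θ| ≤ δ → HasDerivAt (F m) (F (m + 1) θ) θ) (h0 : ∀ m, 1 ≤ m → F m 0 = 0)
    {n : ℕ} {B : ℝ} (hB : ∀ θ, |θ| ≤ δ → |F n θ| ≤ B) :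
    ∀ j i, 1 ≤ i → i + j = n → ∀ θ, |θ| ≤ δ → |F i θ| ≤ B * |θ| ^ j / j.factorial := by
  intro j
  induction j with
  | zero =>
    intro i _ hij θ hθ
    rw [add_zero] at hij
    subst hij
    simpa using hB θ hθ
  | succ j ih =>
    intro i hi hij θ hθ
    have hseg : ∀ t ∈ Icc (0 : ℝ) 1, |t * θ| ≤ δ := fun t ht => by
      rw [abs_mul, abs_of_nonneg ht.1]
      nlinarith [ht.2, abs_nonneg θ]
    have hder : ∀ t ∈ Icc (0 : ℝ) 1, HasDerivAt (fun t => F i (t * θ)) (F (i + 1) (t * θ) * θ) t :=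
      fun t ht => (hd i _ (hseg t ht)).comp t (hasDerivAt_mul_const θ)
    have hfac : ((j + 1).factorial : ℝ) = (j + 1) * j.factorial := by
      push_cast [Nat.factorial_succ]; ring
    have hj : (j.factorial : ℝ) ≠ 0 := by positivity
    have hj' : (j + 1 : ℝ) ≠ 0 := by positivity
    -- The function is restricted to the segment `t ↦ t θ` and compared with a monomial in `t` of
    -- degree `j + 1`, whose derivative is the inductive bound.
    have := image_norm_le_of_norm_deriv_right_le_deriv_boundary (a := 0) (b := 1)
      (f := fun t => F i (t * θ)) (f' := fun t => F (i + 1) (t * θ) * θ)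
      (B := fun t => B * |θ| ^ (j + 1) / (j + 1).factorial * t ^ (j + 1))
      (B' := fun t => B * |θ| ^ (j + 1) / j.factorial * t ^ j)
      (fun t ht => (hder t ht).continuousAt.continuousWithinAt)
      (fun t ht => (hder t (Ico_subset_Icc_self ht)).hasDerivWithinAt)
      (by simp [h0 i hi])
      (fun t => ((hasDerivAt_pow (j + 1) t).const_mul _).congr_deriv (by
        rw [hfac]; push_cast; field_simp))
      (fun t ht => by
        have h1 := ih (i + 1) (by omega) (by omega) _ (hseg t (Ico_subset_Icc_self ht))
        rw [Real.norm_eq_abs, abs_mul]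
        calc |F (i + 1) (t * θ)| * |θ| ≤ B * |t * θ| ^ j / j.factorial * |θ| := by gcongr
          _ = _ := by rw [abs_mul, abs_of_nonneg ht.1]; ring)
      (right_mem_Icc.2 zero_le_one)
    simpa using this

/-- The derivative of a Gevrey function that is flat at `0` decays exponentially there. -/
theorem exists_flat_bound {s : ℝ} (hs : 1 < s) {U : Set ℝ} (hU : IsOpen U) (hU0 : (0 : ℝ) ∈ U)
    {c : ℝ → ℝ} (hc : MemGevrey s U c) (hflat : ∀ m : ℕ, 1 ≤ m → iteratedDeriv m c 0 = 0) :
    ∃ δ > 0, ∃ K > 0, ∃ κ > 0, ∀ θ, |θ| ≤ δ → θ ∈ U ∧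
      |deriv c θ| ≤ K * Real.exp (-κ * |θ| ^ (-(1 / (s - 1)))) := by
  obtain ⟨hc, C, hC, A, hA, hCA⟩ := hc
  obtain ⟨δ, hδ, hδU⟩ := Metric.nhds_basis_closedBall.mem_iff.1 (hU.mem_nhds hU0)
  have mem : ∀ θ, |θ| ≤ δ → θ ∈ U := fun θ hθ => hδU (by simpa using hθ)
  have hp : 0 < s - 1 := by linarith
  set p := s - 1 with hp_def
  set D := A * 2 ^ s with hD_def
  have hD : 0 < D := by positivity
  have step : ∀ m : ℕ, ∀ θ, |θ| ≤ δ → |deriv c θ| ≤ C * A * (D * |θ| * (m : ℝ) ^ p) ^ m := by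
    intro m θ hθ
    have h1 := abs_le_taylor_of_flat (F := fun m => iteratedDeriv m c) (δ := δ)
      (fun m θ hθ => hasDerivAt_iteratedDeriv_of_contDiffOn hU hc m (mem θ hθ)) hflat
      (fun θ hθ => hCA (m + 1) θ (mem θ hθ)) m 1 le_rfl (add_comm _ _) θ hθ
    rw [iteratedDeriv_one] at h1
    refine h1.trans ?_
    have f0 : (0 : ℝ) < m.factorial := by positivity
    -- The `1 / m!` in Taylor's formula consumes one of the `s` factorial powers; this is where `s -
    -- 1` comes from.
    have e1 : ((m + 1).factorial : ℝ) ^ s = ((m : ℝ) + 1) ^ s * ((m.factorial : ℝ) ^ p * m.factorial) := by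
      rw [Nat.factorial_succ]
      push_cast
      rw [Real.mul_rpow (by positivity) f0.le]
      congr 1
      conv_rhs => rw [← Real.rpow_add_one f0.ne']
      congr 1; rw [hp_def]; ring
    have e2 : ((m : ℝ) + 1) ^ s ≤ (2 ^ s) ^ m := by
      have : (m : ℝ) + 1 ≤ 2 ^ m := by exact_mod_cast Nat.lt_two_pow_self (n := m)
      calc ((m : ℝ) + 1) ^ s ≤ ((2 : ℝ) ^ m) ^ s :=
            Real.rpow_le_rpow (by positivity) this (by linarith)
        _ = (2 ^ s) ^ m := by
            rw [← Real.rpow_natCast, ← Real.rpow_natCast, ← Real.rpow_mul (by norm_num),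
              ← Real.rpow_mul (by norm_num), mul_comm]
    have e3 : (m.factorial : ℝ) ^ p ≤ ((m : ℝ) ^ p) ^ m := by
      have : (m.factorial : ℝ) ≤ (m : ℝ) ^ m := by exact_mod_cast Nat.factorial_le_pow m
      calc (m.factorial : ℝ) ^ p ≤ ((m : ℝ) ^ m) ^ p := Real.rpow_le_rpow f0.le this hp.le
        _ = ((m : ℝ) ^ p) ^ m := by
            rw [← Real.rpow_natCast, ← Real.rpow_natCast, ← Real.rpow_mul (by positivity),
              ← Real.rpow_mul (by positivity), mul_comm]
    rw [e1]
    calc C * A ^ (m + 1) * (((m : ℝ) + 1) ^ s * ((m.factorial : ℝ) ^ p * m.factorial)) * |θ| ^ m /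
          m.factorial = C * A ^ (m + 1) * (((m : ℝ) + 1) ^ s * (m.factorial : ℝ) ^ p) * |θ| ^ m := by
          field_simp
      _ ≤ C * A ^ (m + 1) * ((2 ^ s) ^ m * ((m : ℝ) ^ p) ^ m) * |θ| ^ m := by gcongr
      _ = C * A * (D * |θ| * (m : ℝ) ^ p) ^ m := by
          rw [hD_def, mul_pow, mul_pow, mul_pow]; ring
  -- Chosen so that `X = κ |θ|^(-1/p)` solves `D |θ| X^p = e⁻¹`. Order `⌊X⌋₊` then gives at most
  -- `e^(-⌊X⌋₊) ≤ e · e^(-X)`, hence the extra factor `e` in the constant.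
  set κ := (Real.exp 1 * D) ^ (-(1 / p)) with hκ
  refine ⟨δ, hδ, C * A * Real.exp 1, by positivity, κ, by positivity, fun θ hθ => ⟨mem θ hθ, ?_⟩⟩
  -- At `θ = 0` the real power with negative exponent takes the value `0`, so the right-hand side is
  -- not small there. Uses near `0` therefore also need the separate fact that the derivative
  -- vanishes at `0`.
  rcases eq_or_ne θ 0 with rfl | hθ0
  · have := hflat 1 le_rfl
    rw [iteratedDeriv_one] at this
    rw [this, abs_zero]; positivity
  have ha : 0 < |θ| := abs_pos.2 hθ0
  set X := κ * |θ| ^ (-(1 / p)) with hX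
  have hX0 : 0 < X := by positivity
  have hXp : D * |θ| * X ^ p = Real.exp (-1) := by
    rw [hX, hκ, ← Real.mul_rpow (by positivity) ha.le, ← Real.rpow_mul (by positivity)]
    rw [show -(1 / p) * p = -1 by field_simp, Real.rpow_neg_one, Real.exp_neg]
    field_simp
  have h1 := step ⌊X⌋₊ θ hθ
  have h2 : D * |θ| * (⌊X⌋₊ : ℝ) ^ p ≤ Real.exp (-1) := by
    rw [← hXp]
    gcongr
    exact Nat.floor_le hX0.le
  have h3 : Real.exp (-1) ^ ⌊X⌋₊ ≤ Real.exp 1 * Real.exp (-X) := by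
    rw [← Real.exp_nat_mul, ← Real.exp_add]
    apply Real.exp_le_exp.2
    linarith [Nat.lt_floor_add_one X]
  calc |deriv c θ| ≤ C * A * (D * |θ| * (⌊X⌋₊ : ℝ) ^ p) ^ ⌊X⌋₊ := h1
    _ ≤ C * A * Real.exp (-1) ^ ⌊X⌋₊ := by gcongr
    _ ≤ C * A * (Real.exp 1 * Real.exp (-X)) := by gcongr
    _ = C * A * Real.exp 1 * Real.exp (-κ * |θ| ^ (-(1 / p))) := by rw [neg_mul, ← hX]; ring

/-- A wave speed defined near `0` agrees near `0` with one that is globally close to `1`. -/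
theorem exists_global_speed {c c' : ℝ → ℝ} {δ K : ℝ} (hδ : 0 < δ) (hK : 0 < K)
    (hc : ∀ θ, |θ| ≤ δ → HasDerivAt c (c' θ) θ) (cc' : ContinuousOn c' {θ | |θ| ≤ δ})
    (bc' : ∀ θ, |θ| ≤ δ → |c' θ| ≤ K) (c0 : c 0 = 1) :
    ∃ δ' > 0, δ' ≤ δ ∧ ∃ k k' : ℝ → ℝ, (∀ θ, HasDerivAt k (k' θ) θ) ∧ Continuous k' ∧
      (∀ θ, |k' θ| ≤ K) ∧ (∀ θ, |k θ - 1| ≤ 1 / 100) ∧ ∀ θ, |θ| ≤ δ' → k θ = c θ ∧ k' θ = c' θ := by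
  -- `2 r ≤ δ` keeps the cutoff where `c'` is controlled; `K · 2 r ≤ 1/100` bounds the total
  -- variation of `k` from `1` on each side.
  obtain ⟨r, hr, hrδ, hrK⟩ : ∃ r > 0, 2 * r ≤ δ ∧ K * (2 * r) ≤ 1 / 100 := by
    refine ⟨min (δ / 2) (1 / (200 * K)), by positivity, ?_, ?_⟩
    · linarith [min_le_left (δ / 2) (1 / (200 * K))]
    · calc K * (2 * min (δ / 2) (1 / (200 * K))) ≤ K * (2 * (1 / (200 * K))) := by
            gcongr; exact min_le_right _ _
        _ = 1 / 100 := by field_simp; norm_num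
  have h2r : 0 < 2 * r := by linarith
  let h : ℝ → ℝ := fun θ => max 0 (min 1 (2 - |θ| / r))
  let d : ℝ → ℝ := fun θ => h θ * c' (truncate (2 * r) θ)
  have ch : Continuous h := by fun_prop
  have cd : Continuous d := ch.mul (cc'.comp_continuous (continuous_truncate _)
    fun θ => (abs_truncate_le h2r θ).trans hrδ)
  have h01 : ∀ θ, |h θ| ≤ 1 := fun θ => by
    rw [abs_of_nonneg (le_max_left _ _)]
    exact max_le zero_le_one (min_le_left _ _)
  have bd : ∀ θ, |d θ| ≤ K := fun θ => by
    have h2 := bc' _ ((abs_truncate_le h2r θ).trans hrδ)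
    rw [abs_mul]
    nlinarith [h01 θ, abs_nonneg (h θ), abs_nonneg (c' (truncate (2 * r) θ))]
  have dzero : ∀ θ, 2 * r ≤ |θ| → d θ = 0 := fun θ hθ => by
    have : 2 ≤ |θ| / r := by rwa [le_div_iff₀ hr]
    have : h θ = 0 := max_eq_left ((min_le_right _ _).trans (by linarith))
    simp [d, this]
  have deq : ∀ θ, |θ| ≤ r → d θ = c' θ := fun θ hθ => by
    have h1 : |θ| / r ≤ 1 := by rw [div_le_iff₀ hr]; linarith
    have h2 : h θ = 1 := by
      simp only [h]
      rw [min_eq_left (by linarith), max_eq_right zero_le_one]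
    simp only [d, h2, one_mul]
    rw [truncate_of_abs_le (by linarith)]
  -- `d` vanishes beyond `2 r`, so its primitive is constant there and only a length of at most `2
  -- r` counts.
  have tail : ∀ θ, ∫ y in (0 : ℝ)..θ, d y = ∫ y in (0 : ℝ)..truncate (2 * r) θ, d y := fun θ => by
    rw [← intervalIntegral.integral_add_adjacent_intervals
      (cd.intervalIntegrable 0 (truncate (2 * r) θ)) (cd.intervalIntegrable _ θ)]
    have : ∫ y in truncate (2 * r) θ..θ, d y = 0 := by
      rcases le_or_gt |θ| (2 * r) with hθ | hθ
      · rw [truncate_of_abs_le hθ, intervalIntegral.integral_same]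
      · rw [intervalIntegral.integral_congr (g := fun _ => 0), intervalIntegral.integral_zero]
        intro y hy
        refine dzero y ?_
        rcases lt_abs.1 hθ with h1 | h1
        · have e : truncate (2 * r) θ = 2 * r := by
            unfold truncate; rw [min_eq_left h1.le, max_eq_right (by linarith)]
          rw [e, uIcc_of_le h1.le] at hy
          exact hy.1.trans (le_abs_self y)
        · have e : truncate (2 * r) θ = -(2 * r) := by
            unfold truncate; rw [min_eq_right (by linarith), max_eq_left (by linarith)]
          rw [e, uIcc_of_ge (by linarith)] at hy
          exact (by linarith [hy.2] : 2 * r ≤ -y).trans (neg_le_abs y)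
    rw [this, add_zero]
  refine ⟨r, hr, by linarith, fun θ => 1 + ∫ y in (0 : ℝ)..θ, d y, d, fun θ => ?_, cd, bd, fun θ => ?_,
    fun θ hθ => ⟨?_, deq θ hθ⟩⟩
  · exact (intervalIntegral.integral_hasDerivAt_right (cd.intervalIntegrable _ _)
      cd.aestronglyMeasurable.stronglyMeasurableAtFilter cd.continuousAt).const_add 1
  · rw [add_sub_cancel_left, tail]
    have h1 := intervalIntegral.norm_integral_le_of_norm_le_const (a := 0)
      (b := truncate (2 * r) θ) (f := d) (C := K) (fun y _ => bd y)
    rw [sub_zero, Real.norm_eq_abs] at h1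
    nlinarith [abs_truncate_le h2r θ]
  · have hy : ∀ y ∈ uIcc 0 θ, |y| ≤ r := fun y hy => by
      have := abs_sub_left_of_mem_uIcc hy
      rw [sub_zero, sub_zero] at this
      exact this.trans hθ
    have : ∫ y in (0 : ℝ)..θ, d y = c θ - c 0 :=
      intervalIntegral.integral_eq_sub_of_hasDerivAt
        (fun y hy' => by rw [deq y (hy y hy')]; exact hc y (by linarith [hy y hy']))
        (cd.intervalIntegrable _ _)
    simp only [this, c0]; ring

/-- Classical derivatives and a common bound for data `φ ∈ C_b²`, `ψ ∈ C_b¹`. -/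
theorem exists_data_bound {φ ψ : ℝ → ℝ} (hφ : MemCb 2 φ) (hψ : MemCb 1 ψ) :
    (∀ x, HasDerivAt φ (deriv φ x) x) ∧ (∀ x, HasDerivAt (deriv φ) (deriv (deriv φ) x) x) ∧
    (∀ x, HasDerivAt ψ (deriv ψ x) x) ∧ Continuous (deriv (deriv φ)) ∧ Continuous (deriv ψ) ∧
    ∃ M ≥ 1, ∀ x, |φ x| ≤ M ∧ |deriv φ x| ≤ M ∧ |deriv (deriv φ) x| ≤ M ∧ |ψ x| ≤ M ∧
      |deriv ψ x| ≤ M := by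
  obtain ⟨cφ, bφ⟩ := hφ
  obtain ⟨cψ, bψ⟩ := hψ
  have cφ' : ContDiff ℝ (1 + 1) φ := by exact_mod_cast cφ
  have c1 : ContDiff ℝ 1 (deriv φ) := (contDiff_succ_iff_deriv.1 cφ').2.2
  have cψ' : ContDiff ℝ 1 ψ := by exact_mod_cast cψ
  obtain ⟨M0, h0⟩ := bφ 0 (by norm_num)
  obtain ⟨M1, h1⟩ := bφ 1 (by norm_num)
  obtain ⟨M2, h2⟩ := bφ 2 (by norm_num)
  obtain ⟨N0, g0⟩ := bψ 0 (by norm_num)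
  obtain ⟨N1, g1⟩ := bψ 1 (by norm_num)
  simp only [iteratedDeriv_zero, iteratedDeriv_one] at h0 h1 g0 g1
  rw [iteratedDeriv_succ, iteratedDeriv_one] at h2
  refine ⟨fun x => ((cφ.differentiable (by norm_num)) x).hasDerivAt,
    fun x => ((c1.differentiable (by norm_num)) x).hasDerivAt,
    fun x => ((cψ'.differentiable (by norm_num)) x).hasDerivAt,
    c1.continuous_deriv_one, cψ'.continuous_deriv_one,
    max 1 (max M0 (max M1 (max M2 (max N0 N1)))), le_max_left _ _, fun x => ?_⟩
  exact ⟨(h0 x).trans (by simp), (h1 x).trans (by simp), (h2 x).trans (by simp),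
    (g0 x).trans (by simp), (g1 x).trans (by simp)⟩

theorem continuousOn_deriv_of_contDiffOn {c : ℝ → ℝ} {U : Set ℝ} (hU : IsOpen U)
    (hc : ContDiffOn ℝ ∞ c U) : ContinuousOn (deriv c) U := fun θ hθ => by
  have := hasDerivAt_iteratedDeriv_of_contDiffOn hU hc 1 hθ
  rw [iteratedDeriv_one] at this
  exact this.continuousAt.continuousWithinAt

/-- A Gevrey wave speed that is flat at `0`, replaced away from `0` by one that is globally close
to `1`. -/
theorem exists_flat_global_speed {s : ℝ} (hs : 1 < s) {U : Set ℝ} (hU : IsOpen U)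
    (hU0 : (0 : ℝ) ∈ U) {c : ℝ → ℝ} (hc : MemGevrey s U c) (hc0 : c 0 = 1)
    (hflat : ∀ m : ℕ, 1 ≤ m → iteratedDeriv m c 0 = 0) :
    ∃ δ > 0, ∃ K > 0, ∃ κ > 0, ∃ k k' : ℝ → ℝ, (∀ θ, HasDerivAt k (k' θ) θ) ∧ Continuous k' ∧
      (∀ θ, |k' θ| ≤ K) ∧ (∀ θ, |k θ - 1| ≤ 1 / 100) ∧ k' 0 = 0 ∧
      ∀ θ, |θ| ≤ δ → θ ∈ U ∧ k θ = c θ ∧ k' θ = deriv c θ ∧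
        |k' θ| ≤ K * Real.exp (-κ * |θ| ^ (-(1 / (s - 1)))) := by
  obtain ⟨δ, hδ, K, hK, κ, hκ, hflatb⟩ := exists_flat_bound hs hU hU0 hc hflat
  have hp : 0 < s - 1 := by linarith
  have dc : ∀ θ, |θ| ≤ δ → HasDerivAt c (deriv c θ) θ := fun θ hθ => by
    have := hasDerivAt_iteratedDeriv_of_contDiffOn hU hc.1 0 (hflatb θ hθ).1
    rwa [zero_add, iteratedDeriv_one, iteratedDeriv_zero] at this
  obtain ⟨δ', hδ', hδδ', k, k', hk, ck', bk', k1, hkc⟩ := exists_global_speed (c := c)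
    (c' := deriv c) hδ hK dc
    ((continuousOn_deriv_of_contDiffOn hU hc.1).mono fun θ hθ => (hflatb θ hθ).1)
    (fun θ hθ => (hflatb θ hθ).2.trans (mul_le_of_le_one_right hK.le (by
      rw [Real.exp_le_one_iff, neg_mul, neg_nonpos]; positivity))) hc0
  refine ⟨δ', hδ', K, hK, κ, hκ, k, k', hk, ck', bk', k1, ?_, fun θ hθ => ?_⟩
  · have := hflat 1 le_rfl
    rwa [iteratedDeriv_one, ← (hkc 0 (by simpa using hδ'.le)).2] at this
  · obtain ⟨e1, e2⟩ := hkc θ hθ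
    obtain ⟨e3, e4⟩ := hflatb θ (hθ.trans hδδ')
    exact ⟨e3, e1, e2, by rwa [e2]⟩

/-- Lower bound for the lifespan. -/
theorem le_lifespan {s : ℝ} (hs : 1 < s) {U : Set ℝ} (hU : IsOpen U) (hU0 : (0 : ℝ) ∈ U)
    {c : ℝ → ℝ} (hc : MemGevrey s U c) (hc0 : c 0 = 1)
    (hflat : ∀ m : ℕ, 1 ≤ m → iteratedDeriv m c 0 = 0)
    {φ ψ : ℝ → ℝ} (hφ : MemCb 2 φ) (hψ : MemCb 1 ψ) :
    ∃ ε₀ > (0 : ℝ), ∃ C₁ > (0 : ℝ), ∃ C₂ > (0 : ℝ), ∀ ε : ℝ, 0 < ε → ε ≤ ε₀ →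
      ENNReal.ofReal (C₁ * Real.exp (C₂ * ε ^ (-(1 / (s - 1))))) ≤
        lifespan c U (fun x => ε * φ x) (fun x => ε * ψ x) := by
  obtain ⟨δ, hδ, K, hK, κ, hκ, k, k', hk, ck', -, k1, k'0, hkc⟩ :=
    exists_flat_global_speed hs hU hU0 hc hc0 hflat
  have hp : 0 < s - 1 := by linarith
  set p := s - 1
  obtain ⟨dφ, ddφ, dψ, cφ'', cψ', M, hM, hbd⟩ := exists_data_bound hφ hψ
  have hM0 : 0 < M := by linarith
  -- With `m = ε M` this gives `4 m ≤ δ` and `m ≤ 1/4`. The time reached is `L / 4` with `L = 1 /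
  -- (100 η)`, hence `1 / (400 K)`.
  refine ⟨min (δ / (4 * M)) (1 / (4 * M)), by positivity, 1 / (400 * K), by positivity,
    κ * (4 * M) ^ (-(1 / p)), by positivity, fun ε hε hεle => ?_⟩
  have e1 : 4 * (ε * M) ≤ δ := by
    have := hεle.trans (min_le_left _ _)
    rw [le_div_iff₀ (by positivity)] at this
    linarith
  have e2 : ε * M ≤ 1 / 4 := by
    have := hεle.trans (min_le_right _ _)
    rw [le_div_iff₀ (by positivity)] at this
    linarith
  set η := K * Real.exp (-κ * (4 * (ε * M)) ^ (-(1 / p))) with hη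
  have hη0 : 0 < η := by positivity
  have scale : ∀ {h : ℝ → ℝ} {x : ℝ}, |h x| ≤ M → |ε * h x| ≤ ε * M := fun {h x} hx => by
    rw [abs_mul, abs_of_pos hε]; exact mul_le_mul_of_nonneg_left hx hε.le
  have sol := hasBoundedSolution_of_slow_speed (c := c) (U := U) hk ck' k1
    (fun x => (dφ x).const_mul ε) (fun x => (ddφ x).const_mul ε) (fun x => (dψ x).const_mul ε)
    (by fun_prop) (by fun_prop) e2 (fun x => scale (hbd x).1) (fun x => scale (hbd x).2.1)
    (fun x => scale (hbd x).2.2.1) (fun x => scale (hbd x).2.2.2.1)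
    (fun x => scale (hbd x).2.2.2.2) (η := η) (L := 1 / (100 * η)) hη0 (by positivity)
    (le_of_eq (by field_simp))
    (fun θ hθ => by
      rcases eq_or_ne θ 0 with rfl | hθ0
      · rw [k'0, abs_zero]; exact hη0.le
      refine (hkc θ (hθ.trans e1)).2.2.2.trans ?_
      have : (4 * (ε * M)) ^ (-(1 / p)) ≤ |θ| ^ (-(1 / p)) :=
        Real.rpow_le_rpow_of_nonpos (abs_pos.2 hθ0) hθ (by rw [neg_nonpos]; positivity)
      rw [hη, neg_mul, neg_mul]
      gcongr)
    (fun θ hθ => ⟨(hkc θ (hθ.trans e1)).1, (hkc θ (hθ.trans e1)).2.1.symm⟩)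
  refine le_sSup ⟨1 / (100 * η) / 4, by positivity, sol, ?_⟩
  congr 1
  rw [hη, neg_mul, Real.exp_neg, show 4 * (ε * M) = (4 * M) * ε by ring,
    Real.mul_rpow (by positivity) hε.le]
  field_simp
  norm_num

/-! ### Characteristics and Riemann invariants of a given solution. -/

/-- A bounded `C¹` solution of `v_t = w_x`, `w_t = k(v)² v_x` on `[0, τ] × ℝ`, continuously
extended to all times. -/
structure IsSlabSolution (k : ℝ → ℝ) (τ M : ℝ) (v w vx wx : ℝ × ℝ → ℝ) : Prop where
  cont_v : Continuous v
  cont_w : Continuous w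
  cont_vx : Continuous vx
  cont_wx : Continuous wx
  bound_vx : ∀ p, |vx p| ≤ M
  bound_wx : ∀ p, |wx p| ≤ M
  deriv_v : ∀ t x, HasDerivAt (fun y => v (t, y)) (vx (t, x)) x
  deriv_w : ∀ t x, HasDerivAt (fun y => w (t, y)) (wx (t, x)) x
  deriv_vt : ∀ t ∈ Ioo 0 τ, ∀ x, HasDerivAt (fun s => v (s, x)) (wx (t, x)) t
  deriv_wt : ∀ t ∈ Ioo 0 τ, ∀ x, HasDerivAt (fun s => w (s, x)) (k (v (t, x)) ^ 2 * vx (t, x)) t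

theorem abs_sub_le_of_hasDerivAt {f f' : ℝ → ℝ} {K : ℝ} (hf : ∀ x, HasDerivAt f (f' x) x)
    (hK : ∀ x, |f' x| ≤ K) (x y : ℝ) : |f x - f y| ≤ K * |x - y| :=
  convex_univ.norm_image_sub_le_of_norm_hasDerivWithin_le
    (fun z _ => (hf z).hasDerivWithinAt) (fun z _ => hK z) (mem_univ y) (mem_univ x)

namespace IsSlabSolution

variable {k k' : ℝ → ℝ} {τ M K : ℝ} {v w vx wx : ℝ × ℝ → ℝ}

/-- The chain rule along a curve needs joint differentiability, which follows from the continuity of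
the partial derivatives `v_t = w_x` and `v_x` on the open slab. -/
theorem hasDerivAt_v_along (h : IsSlabSolution k τ M v w vx wx)
    {X : ℝ → ℝ} {X' t : ℝ} (ht : t ∈ Ioo 0 τ) (hX : HasDerivAt X X' t) :
    HasDerivAt (fun s => v (s, X s)) (wx (t, X t) + X' * vx (t, X t)) t := by
  have hd := (hasStrictFDerivAt_of_partials (f := v) (fa := wx) (fb := vx)
    (s := Ioo 0 τ ×ˢ univ) (isOpen_Ioo.prod isOpen_univ) h.cont_wx.continuousOn
    h.cont_vx.continuousOn (fun z hz => h.deriv_vt z.1 hz.1 z.2) (fun z _ => h.deriv_v z.1 z.2)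
    (z := (t, X t)) ⟨ht, mem_univ _⟩).hasFDerivAt
  refine (hd.comp_hasDerivAt t ((hasDerivAt_id t).prodMk hX)).congr_deriv ?_
  simp [mul_comm]

theorem hasDerivAt_w_along (h : IsSlabSolution k τ M v w vx wx) (hk : Continuous k)
    {X : ℝ → ℝ} {X' t : ℝ} (ht : t ∈ Ioo 0 τ) (hX : HasDerivAt X X' t) :
    HasDerivAt (fun s => w (s, X s)) (k (v (t, X t)) ^ 2 * vx (t, X t) + X' * wx (t, X t)) t := by
  have cv := h.cont_v
  have cvx := h.cont_vx
  have hd := (hasStrictFDerivAt_of_partials (f := w) (fa := fun p => k (v p) ^ 2 * vx p) (fb := wx)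
    (s := Ioo 0 τ ×ˢ univ) (isOpen_Ioo.prod isOpen_univ)
    (by fun_prop : Continuous fun p => k (v p) ^ 2 * vx p).continuousOn
    h.cont_wx.continuousOn (fun z hz => h.deriv_wt z.1 hz.1 z.2) (fun z _ => h.deriv_w z.1 z.2)
    (z := (t, X t)) ⟨ht, mem_univ _⟩).hasFDerivAt
  refine (hd.comp_hasDerivAt t ((hasDerivAt_id t).prodMk hX)).congr_deriv ?_
  simp [mul_comm]

/-- Derivative of the Riemann invariant `w + σ F(v)` along a curve. -/
theorem hasDerivAt_invariant_along (h : IsSlabSolution k τ M v w vx wx) (hk : Continuous k)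
    {F : ℝ → ℝ} (hF : ∀ θ, HasDerivAt F (k θ) θ) (σ : ℝ)
    {X : ℝ → ℝ} {X' t : ℝ} (ht : t ∈ Ioo 0 τ) (hX : HasDerivAt X X' t) :
    HasDerivAt (fun s => w (s, X s) + σ * F (v (s, X s)))
      (k (v (t, X t)) ^ 2 * vx (t, X t) + X' * wx (t, X t) +
        σ * (k (v (t, X t)) * (wx (t, X t) + X' * vx (t, X t)))) t :=
  (h.hasDerivAt_w_along hk ht hX).add
    (((hF _).comp t (h.hasDerivAt_v_along ht hX)).const_mul σ)

/-- Existence of characteristics `X' = -σ k(v)`. -/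
theorem exists_characteristic (h : IsSlabSolution k τ M v w vx wx)
    (hk : ∀ θ, HasDerivAt k (k' θ) θ) (bk' : ∀ θ, |k' θ| ≤ K)
    (k1 : ∀ θ, |k θ - 1| ≤ 1 / 100) {σ : ℝ} (hσ : |σ| = 1) {t₀ : ℝ} (ht₀ : t₀ ∈ Icc 0 τ) (x₀ : ℝ) :
    ∃ X : ℝ → ℝ, Continuous X ∧ X t₀ = x₀ ∧
      ∀ t ∈ Ioo 0 τ, HasDerivAt X (-(σ * k (v (t, X t)))) t := by
  have ck : Continuous k := continuous_iff_continuousAt.2 fun θ => (hk θ).continuousAt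
  have cv := h.cont_v
  have K0 : 0 ≤ K := (abs_nonneg _).trans (bk' 0)
  have M0 : 0 ≤ M := (abs_nonneg _).trans (h.bound_vx 0)
  have τ0 : 0 ≤ τ := ht₀.1.trans ht₀.2
  have hPL : IsPicardLindelof (fun t x => -(σ * k (v (t, x)))) (tmin := 0) (tmax := τ) ⟨t₀, ht₀⟩ x₀
      -- Speeds are at most `101/100 ≤ 2`, so a ball of radius `2 τ` cannot be left; `K * M` is the
      -- Lipschitz constant of `x ↦ k (v (t, x))`.
      ⟨2 * τ, by positivity⟩ 0 2 ⟨K * M, by positivity⟩ := by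
    refine ⟨fun t _ => LipschitzOnWith.of_dist_le_mul fun x _ y _ => ?_,
      fun x _ => Continuous.continuousOn (by fun_prop), fun t _ x _ => ?_, ?_⟩
    · rw [dist_neg_neg, Real.dist_eq, ← mul_sub, abs_mul, hσ, one_mul, Real.dist_eq]
      calc |k (v (t, x)) - k (v (t, y))| ≤ K * |v (t, x) - v (t, y)| :=
            abs_sub_le_of_hasDerivAt hk bk' _ _
        _ ≤ K * (M * |x - y|) := by
            gcongr
            exact abs_sub_le_of_hasDerivAt (f := fun y => v (t, y)) (f' := fun y => vx (t, y))
              (h.deriv_v t) (fun y => h.bound_vx _) _ _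
        _ = K * M * |x - y| := by ring
    · rw [norm_neg, Real.norm_eq_abs, abs_mul, hσ, one_mul, abs_le]
      have := abs_le.1 (k1 (v (t, x)))
      push_cast
      constructor <;> linarith [this.1, this.2]
    · simp only [NNReal.coe_zero, sub_zero, NNReal.coe_ofNat]
      have : max (τ - t₀) t₀ ≤ τ := max_le (by linarith [ht₀.1]) ht₀.2
      exact mul_le_mul_of_nonneg_left this two_pos.le
  obtain ⟨Y, hY0, hY⟩ := hPL.exists_eq_forall_mem_Icc_hasDerivWithinAt₀
  have cY : ContinuousOn Y (Icc 0 τ) := fun t ht => (hY t ht).continuousWithinAt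
  refine ⟨fun t => Y (projIcc 0 τ τ0 t), ?_, ?_, fun t ht => ?_⟩
  · exact cY.comp_continuous (by fun_prop) fun t => (projIcc 0 τ τ0 t).2
  · beta_reduce; rw [projIcc_of_mem τ0 ht₀]; exact hY0
  · have hnhds := Icc_mem_nhds ht.1 ht.2
    have hd := (hY t (Ioo_subset_Icc_self ht)).hasDerivAt hnhds
    have e : (projIcc 0 τ τ0 t : ℝ) = t := by rw [projIcc_of_mem τ0 (Ioo_subset_Icc_self ht)]
    beta_reduce
    rw [e]
    refine hd.congr_of_eventuallyEq ?_
    filter_upwards [hnhds] with s hs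
    rw [projIcc_of_mem τ0 hs]

/-- Riemann invariants are constant along characteristics. -/
theorem invariant_eq (h : IsSlabSolution k τ M v w vx wx) (hk : Continuous k)
    {F : ℝ → ℝ} (hF : ∀ θ, HasDerivAt F (k θ) θ) {σ : ℝ} (hσ : |σ| = 1) {X : ℝ → ℝ}
    (cX : Continuous X) (hX : ∀ t ∈ Ioo 0 τ, HasDerivAt X (-(σ * k (v (t, X t)))) t)
    {t : ℝ} (ht : t ∈ Icc 0 τ) :
    w (t, X t) + σ * F (v (t, X t)) = w (0, X 0) + σ * F (v (0, X 0)) := by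
  have cF : Continuous F := continuous_iff_continuousAt.2 fun θ => (hF θ).continuousAt
  have cv := h.cont_v
  have cw := h.cont_w
  have hσ2 : σ ^ 2 = 1 := by rw [← sq_abs, hσ, one_pow]
  have := intervalIntegral.integral_eq_sub_of_hasDerivAt_of_le (a := 0) (b := t) ht.1
    (f := fun s => w (s, X s) + σ * F (v (s, X s))) (f' := fun _ => 0)
    (Continuous.continuousOn (by fun_prop))
    (fun s hs => by
      have hs' : s ∈ Ioo 0 τ := ⟨hs.1, hs.2.trans_le ht.2⟩
      refine (h.hasDerivAt_invariant_along hk hF σ hs' (hX s hs')).congr_deriv ?_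
      linear_combination -(k (v (s, X s)) ^ 2 * vx (s, X s)) * hσ2)
    intervalIntegrable_const
  rw [intervalIntegral.integral_zero] at this
  linarith

/-- The value of a Riemann invariant at a point is attained by the data at the foot of the
characteristic, which lies on the expected side. -/
theorem exists_foot (h : IsSlabSolution k τ M v w vx wx)
    (hk : ∀ θ, HasDerivAt k (k' θ) θ) (bk' : ∀ θ, |k' θ| ≤ K)
    (k1 : ∀ θ, |k θ - 1| ≤ 1 / 100) {F : ℝ → ℝ} (hF : ∀ θ, HasDerivAt F (k θ) θ)
    {σ : ℝ} (hσ : |σ| = 1) {t : ℝ} (ht : t ∈ Icc 0 τ) (x : ℝ) :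
    ∃ y, (σ = -1 → y ≤ x - 99 / 100 * t) ∧
      w (t, x) + σ * F (v (t, x)) = w (0, y) + σ * F (v (0, y)) := by
  have ck : Continuous k := continuous_iff_continuousAt.2 fun θ => (hk θ).continuousAt
  obtain ⟨X, cX, X0, hX⟩ := h.exists_characteristic hk bk' k1 hσ ht x
  refine ⟨X 0, ?_, ?_⟩
  · rintro rfl
    have := (convex_Icc 0 τ).mul_sub_le_image_sub_of_le_deriv (f := X) (C := 99 / 100)
      cX.continuousOn
      (fun s hs => by
        rw [interior_Icc] at hs
        exact (hX s hs).differentiableAt.differentiableWithinAt)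
      (fun s hs => by
        rw [interior_Icc] at hs
        rw [(hX s hs).deriv]
        have := abs_le.1 (k1 (v (s, X s)))
        linarith [this.1]) 0 (left_mem_Icc.2 (ht.1.trans ht.2)) t ht ht.1
    rw [X0] at this
    linarith
  · rw [← h.invariant_eq ck hF hσ cX hX ht, X0]

/-- Evolution of the derivative of the invariant `w + F(v)` along its characteristics. -/
theorem deriv_invariant_eq_integral (h : IsSlabSolution k τ M v w vx wx)
    (hk : ∀ θ, HasDerivAt k (k' θ) θ) (bk' : ∀ θ, |k' θ| ≤ K)
    (k1 : ∀ θ, |k θ - 1| ≤ 1 / 100) {X : ℝ → ℝ}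
    (cX : Continuous X) (hX : ∀ t ∈ Ioo 0 τ, HasDerivAt X (-k (v (t, X t))) t)
    {t : ℝ} (ht : t ∈ Icc 0 τ) :
    (wx (t, X t) + k (v (t, X t)) * vx (t, X t)) - (wx (0, X 0) + k (v (0, X 0)) * vx (0, X 0)) =
      ∫ r in (0 : ℝ)..t, (k' (v (r, X r)) * vx (r, X r)) *
        (wx (r, X r) + k (v (r, X r)) * vx (r, X r)) := by
  have ck : Continuous k := continuous_iff_continuousAt.2 fun θ => (hk θ).continuousAt
  have cv := h.cont_v
  have cw := h.cont_w
  have cvx := h.cont_vx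
  have cwx := h.cont_wx
  have M0 : 0 ≤ M := (abs_nonneg _).trans (h.bound_vx 0)
  have K0 : 0 ≤ K := (abs_nonneg _).trans (bk' 0)
  obtain ⟨F, -, hF, -⟩ := exists_primitive_inverse ck k1
  have cF : Continuous F := continuous_iff_continuousAt.2 fun θ => (hF θ).continuousAt
  -- Differentiating `S_x` directly along `X` would involve second derivatives of `v` and `w`.
  -- Instead `S (r, X r + e) - S (r, X r)` has derivative `(k(v(X + e)) - k(v(X))) S_x(X + e)`;
  -- dividing by `e`, integrating and letting `e → 0` by dominated convergence gives the formula.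
  let S : ℝ × ℝ → ℝ := fun p => w p + 1 * F (v p)
  let Sx : ℝ × ℝ → ℝ := fun p => wx p + k (v p) * vx p
  have cS : Continuous S := by fun_prop
  have cSx : Continuous Sx := by fun_prop
  have bSx : ∀ p, |Sx p| ≤ 3 * M := fun p => by
    have := abs_le.1 (k1 (v p))
    have hk2 : |k (v p)| ≤ 2 := by rw [abs_le]; constructor <;> linarith [this.1, this.2]
    refine (abs_add_le _ _).trans ?_
    rw [abs_mul]
    nlinarith [h.bound_vx p, h.bound_wx p, abs_nonneg (vx p), abs_nonneg (k (v p))]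
  have hSx : ∀ r x, HasDerivAt (fun y => S (r, y)) (Sx (r, x)) x := fun r x =>
    ((h.deriv_w r x).add (((hF _).comp x (h.deriv_v r x)).const_mul 1)).congr_deriv (by
      simp only [Sx]; ring)
  have hkx : ∀ r x, HasDerivAt (fun y => k (v (r, y))) (k' (v (r, x)) * vx (r, x)) x := fun r x =>
    (hk _).comp x (h.deriv_v r x)
  have bkx : ∀ r x y, |k (v (r, x)) - k (v (r, y))| ≤ K * M * |x - y| := fun r x y =>
    abs_sub_le_of_hasDerivAt (hkx r) (fun z => by
      rw [abs_mul]; exact mul_le_mul (bk' _) (h.bound_vx _) (abs_nonneg _) K0) x y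
  -- identity for difference quotients
  have hquot : ∀ e : ℝ, (∫ r in (0 : ℝ)..t,
      e⁻¹ * (k (v (r, X r + e)) - k (v (r, X r))) * Sx (r, X r + e)) =
      e⁻¹ * (S (t, X t + e) - S (t, X t)) - e⁻¹ * (S (0, X 0 + e) - S (0, X 0)) := fun e => by
    refine intervalIntegral.integral_eq_sub_of_hasDerivAt_of_le ht.1
      (f := fun r => e⁻¹ * (S (r, X r + e) - S (r, X r))) (Continuous.continuousOn (by fun_prop))
      (fun r hr => ?_) (Continuous.intervalIntegrable (by fun_prop) _ _)
    have hr' : r ∈ Ioo 0 τ := ⟨hr.1, hr.2.trans_le ht.2⟩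
    have d1 := h.hasDerivAt_invariant_along ck hF 1 hr' (X := fun r => X r + e)
      ((hX r hr').add_const e)
    have d2 := h.hasDerivAt_invariant_along ck hF 1 hr' (hX r hr')
    refine ((d1.sub d2).const_mul e⁻¹).congr_deriv ?_
    simp only [Sx]; ring
  have slope : ∀ r, Tendsto (fun e => e⁻¹ * (S (r, X r + e) - S (r, X r))) (𝓝[≠] 0)
      (𝓝 (Sx (r, X r))) := fun r => (hSx r (X r)).tendsto_slope_zero
  have lim1 := (slope t).sub (slope 0)
  have lim2 : Tendsto (fun e => ∫ r in (0 : ℝ)..t,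
      e⁻¹ * (k (v (r, X r + e)) - k (v (r, X r))) * Sx (r, X r + e)) (𝓝[≠] 0)
      (𝓝 (∫ r in (0 : ℝ)..t, (k' (v (r, X r)) * vx (r, X r)) * Sx (r, X r))) := by
    refine intervalIntegral.tendsto_integral_filter_of_dominated_convergence
      (fun _ => K * M * (3 * M)) ?_ ?_ intervalIntegrable_const ?_
    · exact Eventually.of_forall fun e =>
        (by fun_prop : Continuous fun r =>
          e⁻¹ * (k (v (r, X r + e)) - k (v (r, X r))) * Sx (r, X r + e)).aestronglyMeasurable
    · filter_upwards [self_mem_nhdsWithin] with e he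
      refine Eventually.of_forall fun r _ => ?_
      have he' : 0 < |e| := abs_pos.2 he
      have h1 := bkx r (X r + e) (X r)
      rw [add_sub_cancel_left] at h1
      rw [Real.norm_eq_abs, abs_mul, abs_mul, abs_inv]
      refine mul_le_mul ?_ (bSx _) (abs_nonneg _) (by positivity)
      rw [inv_mul_le_iff₀ he']
      linarith
    · refine Eventually.of_forall fun r _ => ?_
      refine Tendsto.mul (hkx r (X r)).tendsto_slope_zero ?_
      have : Continuous fun e => Sx (r, X r + e) := by fun_prop
      have h0 := this.tendsto 0
      rw [add_zero] at h0
      exact h0.mono_left nhdsWithin_le_nhds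
  refine tendsto_nhds_unique lim1 (lim2.congr fun e => ?_)
  exact hquot e

end IsSlabSolution

/-! ### Riccati blow-up and a priori bounds. -/

/-- Blow-up time of a Riccati differential inequality. -/
theorem riccati_time_le {Y A : ℝ → ℝ} {τ t₀ ϑ : ℝ} (ht₀ : 0 ≤ t₀) (htτ : t₀ ≤ τ)
    (cY : ContinuousOn Y (Icc 0 τ)) (hY : ∀ t ∈ Ioo 0 τ, HasDerivAt Y (A t * Y t ^ 2) t)
    (hA : ∀ t ∈ Ioo 0 τ, 0 ≤ A t) (hϑ : ∀ t ∈ Ioo t₀ τ, ϑ ≤ A t) (hY0 : 0 < Y 0) :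
    ϑ * (τ - t₀) * Y 0 ≤ 1 := by
  have mono : MonotoneOn Y (Icc 0 τ) := by
    refine monotoneOn_of_deriv_nonneg (convex_Icc 0 τ) cY ?_ ?_ <;> rw [interior_Icc]
    · exact fun t ht => (hY t ht).differentiableAt.differentiableWithinAt
    · intro t ht
      rw [(hY t ht).deriv]
      exact mul_nonneg (hA t ht) (sq_nonneg _)
  have h0 : (0 : ℝ) ∈ Icc 0 τ := left_mem_Icc.2 (ht₀.trans htτ)
  have ge : ∀ t ∈ Icc 0 τ, Y 0 ≤ Y t := fun t ht => mono h0 ht ht.1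
  have sub : Icc t₀ τ ⊆ Icc 0 τ := Icc_subset_Icc_left ht₀
  have sub' : Ioo t₀ τ ⊆ Ioo 0 τ := Ioo_subset_Ioo_left ht₀
  -- `(1/Y)' = -A ≤ -ϑ` after `t₀`, while `1/Y` stays positive and is at most `1 / Y 0` at `t₀`.
  have hd : ∀ t ∈ Ioo t₀ τ, HasDerivAt (fun t => (Y t)⁻¹ + ϑ * t) (-A t + ϑ) t := fun t ht => by
    have hpos : Y t ≠ 0 := (hY0.trans_le (ge t (Ioo_subset_Icc_self (sub' ht)))).ne'
    refine (((hY t (sub' ht)).inv hpos).add ((hasDerivAt_id t).const_mul ϑ)).congr_deriv ?_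
    field_simp
  have anti : AntitoneOn (fun t => (Y t)⁻¹ + ϑ * t) (Icc t₀ τ) := by
    refine antitoneOn_of_deriv_nonpos (convex_Icc t₀ τ) ?_ ?_ ?_
    · exact ((cY.mono sub).inv₀ fun t ht => (hY0.trans_le (ge t (sub ht))).ne').add
        (by fun_prop)
    · rw [interior_Icc]
      exact fun t ht => (hd t ht).differentiableAt.differentiableWithinAt
    · rw [interior_Icc]
      intro t ht
      rw [(hd t ht).deriv]
      linarith [hϑ t ht]
  have h1 := anti (left_mem_Icc.2 htτ) (right_mem_Icc.2 htτ) htτ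
  simp only at h1
  have h2 : (Y t₀)⁻¹ ≤ (Y 0)⁻¹ := inv_anti₀ hY0 (ge t₀ (sub (left_mem_Icc.2 htτ)))
  have h3 : 0 < (Y τ)⁻¹ := inv_pos.2 (hY0.trans_le (ge τ (sub (right_mem_Icc.2 htτ))))
  have h4 : ϑ * (τ - t₀) ≤ (Y 0)⁻¹ := by linarith
  calc ϑ * (τ - t₀) * Y 0 ≤ (Y 0)⁻¹ * Y 0 := by gcongr
    _ = 1 := inv_mul_cancel₀ hY0.ne'

namespace IsSlabSolution

variable {k k' : ℝ → ℝ} {τ M K : ℝ} {v w vx wx : ℝ × ℝ → ℝ}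

/-- Bound for the existence time when the derivative of the wave speed is bounded below after
time `t₀` along a characteristic on which the invariant increases in `x`. -/
theorem time_le (h : IsSlabSolution k τ M v w vx wx)
    (hk : ∀ θ, HasDerivAt k (k' θ) θ) (ck' : Continuous k') (bk' : ∀ θ, |k' θ| ≤ K)
    (k1 : ∀ θ, |k θ - 1| ≤ 1 / 100) {F : ℝ → ℝ} (hF : ∀ θ, HasDerivAt F (k θ) θ)
    (hnn : ∀ t ∈ Icc 0 τ, ∀ x, 0 ≤ k' (v (t, x))) {a t₀ ϑ : ℝ} (ht₀ : 0 ≤ t₀)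
    (htτ : t₀ ≤ τ) (hϑ0 : 0 < ϑ)
    (hϑ : ∀ t ∈ Icc t₀ τ, ∀ x ≤ a, w (t, x) + F (v (t, x)) = w (0, a) + F (v (0, a)) →
      ϑ ≤ k' (v (t, x)))
    (ha : 0 < wx (0, a) + k (v (0, a)) * vx (0, a)) :
    ϑ * (τ - t₀) * (wx (0, a) + k (v (0, a)) * vx (0, a)) ≤ 3 := by
  have ck : Continuous k := continuous_iff_continuousAt.2 fun θ => (hk θ).continuousAt
  have cv := h.cont_v
  have cvx := h.cont_vx
  have cwx := h.cont_wx
  have τ0 : 0 ≤ τ := ht₀.trans htτ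
  have rk : ∀ z, 99 / 100 ≤ k z ∧ k z ≤ 101 / 100 := fun z => by
    have := abs_le.1 (k1 z); constructor <;> linarith [this.1, this.2]
  obtain ⟨X, cX, X0, hX⟩ := h.exists_characteristic hk bk' k1 (σ := 1) abs_one
    (left_mem_Icc.2 τ0) a
  have hinv := fun t ht => h.invariant_eq ck hF (σ := 1) abs_one cX hX (t := t) ht
  simp only [one_mul] at hX hinv
  rw [X0] at hinv
  have Xle : ∀ t ∈ Icc 0 τ, X t ≤ a := fun t ht => by
    have := (convex_Icc 0 τ).image_sub_le_mul_sub_of_deriv_le (f := X) (C := 0)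
      cX.continuousOn
      (fun s hs => by
        rw [interior_Icc] at hs
        exact (hX s hs).differentiableAt.differentiableWithinAt)
      (fun s hs => by
        rw [interior_Icc] at hs
        rw [(hX s hs).deriv]
        linarith [rk (v (s, X s))]) 0 (left_mem_Icc.2 τ0) t ht ht.1
    rw [X0] at this
    linarith
  let κ : ℝ → ℝ := fun t => k (v (t, X t))
  let G : ℝ → ℝ := fun t => k' (v (t, X t)) * vx (t, X t)
  let y : ℝ → ℝ := fun t => wx (t, X t) + κ t * vx (t, X t)
  have cy : Continuous y := by fun_prop
  have cG : Continuous G := by fun_prop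
  have rκ : ∀ t, 99 / 100 ≤ κ t ∧ κ t ≤ 101 / 100 := fun t => rk _
  have κpos : ∀ t, 0 < κ t := fun t => by linarith [rκ t]
  have hy : ∀ t ∈ Ioo 0 τ, HasDerivAt y (G t * y t) t := fun t ht => by
    have hc : Continuous fun r => G r * y r := by fun_prop
    have := (intervalIntegral.integral_hasDerivAt_right (hc.intervalIntegrable 0 t)
      hc.aestronglyMeasurable.stronglyMeasurableAtFilter hc.continuousAt).const_add (y 0)
    refine this.congr_of_eventuallyEq ?_
    filter_upwards [Icc_mem_nhds ht.1 ht.2] with s hs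
    have := h.deriv_invariant_eq_integral hk bk' k1 cX hX hs
    change y s - y 0 = ∫ r in (0 : ℝ)..s, G r * y r at this
    linarith
  have hκ : ∀ t ∈ Ioo 0 τ, HasDerivAt κ
      (k' (v (t, X t)) * (wx (t, X t) + -κ t * vx (t, X t))) t := fun t ht =>
    (hk _).comp t (h.hasDerivAt_v_along ht (hX t ht))
  have rsq : ∀ t, 99 / 100 ≤ √(κ t) ∧ √(κ t) ≤ 101 / 100 := fun t => by
    constructor
    · exact Real.le_sqrt_of_sq_le (by norm_num; linarith [rκ t])
    · exact (Real.sqrt_le_left (by norm_num)).2 (by norm_num; linarith [rκ t])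
  -- The weight `√κ` cancels the uncontrolled `v_x`: `y' = k' v_x y` and `κ' = k' (y - 2 κ v_x)`
  -- give `(√κ y)' = k' y² / (2 √κ)`. The constant `205/100` exceeds `2 κ √κ ≤ 2 · 1.01²`.
  have key := riccati_time_le (Y := fun t => √(κ t) * y t)
    (A := fun t => k' (v (t, X t)) / (2 * κ t * √(κ t))) (ϑ := ϑ / (205 / 100)) ht₀ htτ
    (Continuous.continuousOn (by fun_prop))
    (fun t ht => by
      have hs : √(κ t) ≠ 0 := ne_of_gt (by linarith [rsq t])
      have hsq : √(κ t) ^ 2 = κ t := Real.sq_sqrt (κpos t).le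
      refine (((hκ t ht).sqrt (κpos t).ne').mul (hy t ht)).congr_deriv ?_
      simp only [G]
      have hyt : wx (t, X t) = y t - κ t * vx (t, X t) := by simp only [y]; ring
      rw [hyt]
      generalize √(κ t) = q at hs hsq
      generalize y t = yt
      rw [← hsq]
      field_simp
      ring)
    (fun t ht => by
      have := hnn t (Ioo_subset_Icc_self ht) (X t)
      have := κpos t
      positivity)
    (fun t ht => by
      have htI : t ∈ Icc 0 τ := ⟨ht₀.trans ht.1.le, ht.2.le⟩
      have h1 := hϑ t (Ioo_subset_Icc_self ht) (X t) (Xle t htI) (hinv t htI)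
      have h2 : 0 < 2 * κ t * √(κ t) := by
        have := κpos t
        have := rsq t
        nlinarith
      have h3 : 2 * κ t * √(κ t) ≤ 205 / 100 := by
        nlinarith [rκ t, rsq t]
      exact div_le_div₀ (hϑ0.le.trans h1) h1 h2 h3)
    (by
      have e : y 0 = wx (0, a) + k (v (0, a)) * vx (0, a) := by simp only [y, κ, X0]
      have := rsq 0
      rw [e]
      exact mul_pos (by linarith) ha)
  have e : y 0 = wx (0, a) + k (v (0, a)) * vx (0, a) := by simp only [y, κ, X0]
  rw [e] at key
  set Y0 := wx (0, a) + k (v (0, a)) * vx (0, a)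
  have h1 : 0 ≤ ϑ * (τ - t₀) * Y0 := by
    have : 0 ≤ τ - t₀ := by linarith
    positivity
  have h2 : ϑ / (205 / 100) * (τ - t₀) * (√(κ 0) * Y0) =
      (ϑ * (τ - t₀) * Y0) * (√(κ 0) / (205 / 100)) := by ring
  rw [h2] at key
  have h3 := rsq 0
  -- `(205/100) / (99/100) ≤ 3`.
  nlinarith

/-- A priori bound: the solution stays as small as its data. -/
theorem abs_le_of_data (h : IsSlabSolution k τ M v w vx wx)
    (hk : ∀ θ, HasDerivAt k (k' θ) θ) (bk' : ∀ θ, |k' θ| ≤ K)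
    (k1 : ∀ θ, |k θ - 1| ≤ 1 / 100) {m : ℝ} (hv : ∀ x, |v (0, x)| ≤ m) (hw : ∀ x, |w (0, x)| ≤ m)
    {t : ℝ} (ht : t ∈ Icc 0 τ) (x : ℝ) : |v (t, x)| ≤ 4 * m := by
  have ck : Continuous k := continuous_iff_continuousAt.2 fun θ => (hk θ).continuousAt
  obtain ⟨F, V, hF, -, hVF, bF, bV⟩ := exists_primitive_inverse ck k1
  -- `2 F(v)` is the difference of the two invariants, each equal to its value at its own foot on `t
  -- = 0`.
  obtain ⟨y, -, hy⟩ := h.exists_foot hk bk' k1 hF (σ := 1) (by simp) ht x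
  obtain ⟨z, -, hz⟩ := h.exists_foot hk bk' k1 hF (σ := -1) (by simp) ht x
  have m0 : 0 ≤ m := (abs_nonneg _).trans (hv 0)
  have b : ∀ y, |F (v (0, y))| ≤ 101 / 100 * m := fun y =>
    (bF _).trans (by linarith [hv y])
  have hFv : |F (v (t, x))| ≤ 201 / 100 * m := by
    have e1 := abs_le.1 (b y)
    have e2 := abs_le.1 (b z)
    have e3 := abs_le.1 (hw y)
    have e4 := abs_le.1 (hw z)
    rw [abs_le]
    constructor <;> linarith [e1.1, e1.2, e2.1, e2.2, e3.1, e3.2, e4.1, e4.2]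
  have := bV (F (v (t, x)))
  rw [hVF] at this
  linarith

end IsSlabSolution

/-- Restriction of a classical solution with small `u_x` to a slab. -/
theorem IsClassicalSolution.isSlabSolution {c k : ℝ → ℝ} {U : Set ℝ} {f g : ℝ → ℝ} {T M δ : ℝ}
    {u ut ux utt utx uxx : ℝ → ℝ → ℝ} (h : IsClassicalSolution c U f g T u ut ux utt utx uxx)
    (bxx : ∀ t ∈ Ico 0 T, ∀ x, |uxx t x| ≤ M) (btx : ∀ t ∈ Ico 0 T, ∀ x, |utx t x| ≤ M)
    (hkc : ∀ θ, |θ| ≤ δ → k θ = c θ) {τ : ℝ} (hτ : τ ∈ Ico 0 T)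
    (small : ∀ t ∈ Icc 0 τ, ∀ x, |ux t x| ≤ δ) :
    IsSlabSolution k τ M (fun p => ux (projIcc 0 τ hτ.1 p.1) p.2)
      (fun p => ut (projIcc 0 τ hτ.1 p.1) p.2) (fun p => uxx (projIcc 0 τ hτ.1 p.1) p.2)
      (fun p => utx (projIcc 0 τ hτ.1 p.1) p.2) := by
  -- Clamping time to `[0, τ]` makes every function continuous on the plane and changes nothing at
  -- interior times.
  have mem : ∀ t, (projIcc 0 τ hτ.1 t : ℝ) ∈ Ico 0 T := fun t =>
    ⟨(projIcc 0 τ hτ.1 t).2.1, (projIcc 0 τ hτ.1 t).2.2.trans_lt hτ.2⟩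
  have cont : ∀ {q : ℝ → ℝ → ℝ}, ContinuousOn (fun p : ℝ × ℝ => q p.1 p.2) (Ico 0 T ×ˢ univ) →
      Continuous fun p : ℝ × ℝ => q (projIcc 0 τ hτ.1 p.1) p.2 := fun {q} hq =>
    hq.comp_continuous (f := fun p : ℝ × ℝ => ((projIcc 0 τ hτ.1 p.1 : ℝ), p.2)) (by fun_prop)
      fun p => ⟨mem _, mem_univ _⟩
  have inter : ∀ {q : ℝ → ℝ → ℝ} {q' t x : ℝ}, t ∈ Ioo 0 τ →
      HasDerivWithinAt (fun s => q s x) q' (Ico 0 T) t →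
      HasDerivAt (fun s => q (projIcc 0 τ hτ.1 s) x) q' t := fun {q q' t x} ht hq => by
    refine (hq.hasDerivAt (Ico_mem_nhds ht.1 (ht.2.trans hτ.2))).congr_of_eventuallyEq ?_
    filter_upwards [Icc_mem_nhds ht.1 ht.2] with s hs
    rw [projIcc_of_mem hτ.1 hs]
  have eq : ∀ t ∈ Ioo 0 τ, (projIcc 0 τ hτ.1 t : ℝ) = t := fun t ht => by
    rw [projIcc_of_mem hτ.1 (Ioo_subset_Icc_self ht)]
  have sub : ∀ t ∈ Ioo 0 τ, t ∈ Ico 0 T := fun t ht => ⟨ht.1.le, ht.2.trans hτ.2⟩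
  exact
    { cont_v := cont h.cont_ux
      cont_w := cont h.cont_ut
      cont_vx := cont h.cont_uxx
      cont_wx := cont h.cont_utx
      bound_vx := fun p => bxx _ (mem _) _
      bound_wx := fun p => btx _ (mem _) _
      deriv_v := fun t x => h.deriv_xx _ (mem t) x
      deriv_w := fun t x => h.deriv_tx _ (mem t) x
      deriv_vt := fun t ht x => by
        simp only [eq t ht]
        exact inter ht (h.deriv_xt t (sub t ht) x)
      deriv_wt := fun t ht x => by
        simp only [eq t ht]
        rw [hkc _ (small t (Ioo_subset_Icc_self ht) x),
          ← sub_eq_zero.1 (h.equation t (sub t ht) x)]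
        exact inter ht (h.deriv_tt t (sub t ht) x) }

/-- A bounded classical solution with small data has small `u_x` for all times. -/
theorem IsClassicalSolution.abs_ux_le {c k k' : ℝ → ℝ} {U : Set ℝ} {f g : ℝ → ℝ} {T M K δ m : ℝ}
    {u ut ux utt utx uxx : ℝ → ℝ → ℝ} (h : IsClassicalSolution c U f g T u ut ux utt utx uxx)
    (bxx : ∀ t ∈ Ico 0 T, ∀ x, |uxx t x| ≤ M) (btx : ∀ t ∈ Ico 0 T, ∀ x, |utx t x| ≤ M)
    (hk : ∀ θ, HasDerivAt k (k' θ) θ) (bk' : ∀ θ, |k' θ| ≤ K) (k1 : ∀ θ, |k θ - 1| ≤ 1 / 100)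
    (hδ : 0 < δ) (hkc : ∀ θ, |θ| ≤ δ → k θ = c θ) (hm : 8 * m ≤ δ)
    (hux : ∀ x, |ux 0 x| ≤ m) (hg : ∀ x, |g x| ≤ m) {t : ℝ} (ht : t ∈ Ico 0 T) (x : ℝ) :
    |ux t x| ≤ 4 * m := by
  have m0 : 0 ≤ m := (abs_nonneg _).trans (hg 0)
  have T0 : (0 : ℝ) ∈ Ico 0 T := ⟨le_rfl, ht.1.trans_lt ht.2⟩
  have M0 : 0 ≤ M := (abs_nonneg _).trans (btx 0 T0 0)
  have improve : ∀ τ ∈ Ico 0 T, (∀ t ∈ Icc 0 τ, ∀ x, |ux t x| ≤ δ) →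
      ∀ t ∈ Icc 0 τ, ∀ x, |ux t x| ≤ 4 * m := fun τ hτ small t ht x => by
    have hs := h.isSlabSolution bxx btx hkc hτ small
    have e0 : projIcc 0 τ hτ.1 0 = ⟨0, left_mem_Icc.2 hτ.1⟩ := projIcc_of_mem _ _
    have := hs.abs_le_of_data hk bk' k1 (m := m) (fun x => by simpa only [e0] using hux x)
      (fun x => by simp only [e0]; rw [h.initial_ut]; exact hg x) ht x
    simpa only [projIcc_of_mem hτ.1 ht] using this
  have lip : ∀ s ∈ Ico 0 T, ∀ t ∈ Ico 0 T, ∀ x, |ux t x - ux s x| ≤ M * |t - s| :=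
    fun s hs t ht x => (convex_Ico 0 T).norm_image_sub_le_of_norm_hasDerivWithin_le
      (fun r hr => h.deriv_xt r hr x) (fun r hr => btx r hr x) hs ht
  -- Bootstrap: while `|u_x| ≤ δ`, `improve` gives `|u_x| ≤ 4 m ≤ δ/2`. Since `u_x` is `M`-Lipschitz
  -- in time uniformly in `x`, it stays below `δ` for a further time `e`. The uniform step replaces
  -- a compactness argument in the unbounded variable `x`.
  let e := δ / (2 * (M + 1))
  have he : 0 < e := by positivity
  have step : ∀ n : ℕ, ∀ t ∈ Ico 0 T, t ≤ n * e → ∀ x, |ux t x| ≤ 4 * m := by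
    intro n
    induction n with
    | zero =>
      intro t ht htn x
      have : t = 0 := le_antisymm (by simpa using htn) ht.1
      rw [this]
      linarith [hux x]
    | succ n ih =>
      intro t ht htn x
      refine improve t ht (fun r hr y => ?_) t ⟨ht.1, le_rfl⟩ x
      have hrT : r ∈ Ico 0 T := ⟨hr.1, hr.2.trans_lt ht.2⟩
      have hn : 0 ≤ n * e := by positivity
      have hq : min r (n * e) ∈ Ico 0 T := ⟨le_min hr.1 hn, (min_le_left _ _).trans_lt hrT.2⟩
      have h1 := ih _ hq (min_le_right _ _) y
      have h2 := lip _ hq r hrT y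
      have h3 : |r - min r (n * e)| ≤ e := by
        rw [abs_of_nonneg (by linarith [min_le_left r (n * e)])]
        have : r ≤ n * e + e := by
          have := hr.2.trans htn
          push_cast at this
          linarith
        rcases min_cases r (n * e) with ⟨hh, -⟩ | ⟨hh, -⟩ <;> rw [hh] <;> linarith
      have h4 : M * |r - min r (n * e)| ≤ δ / 2 := by
        calc M * |r - min r (n * e)| ≤ (M + 1) * e := by gcongr; linarith
          _ = δ / 2 := by simp only [e]; field_simp
      have h5 := abs_add_le (ux r y - ux (min r (n * e)) y) (ux (min r (n * e)) y)
      rw [sub_add_cancel] at h5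
      linarith
  obtain ⟨n, hn⟩ := exists_nat_ge (t / e)
  exact step n t ht ((div_le_iff₀ he).1 hn) x

/-! ### Reflection, initial values and the upper bound. -/

/-- The reflection `u(t, x) ↦ -u(t, -x)`. -/
theorem HasBoundedSolution.reflect {c : ℝ → ℝ} {U : Set ℝ} {f g : ℝ → ℝ} {T : ℝ}
    (h : HasBoundedSolution c U f g T) :
    HasBoundedSolution c U (fun x => -f (-x)) (fun x => -g (-x)) T := by
  obtain ⟨u, ut, ux, utt, utx, uxx, h, M, hM⟩ := h
  have cont : ∀ {q : ℝ → ℝ → ℝ}, ContinuousOn (fun p : ℝ × ℝ => q p.1 p.2) (Ico 0 T ×ˢ univ) →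
      ContinuousOn (fun p : ℝ × ℝ => q p.1 (-p.2)) (Ico 0 T ×ˢ univ) := fun {q} hq =>
    hq.comp (f := fun p : ℝ × ℝ => (p.1, -p.2)) (by fun_prop) fun p hp => ⟨hp.1, mem_univ _⟩
  have dx : ∀ {q : ℝ → ℝ} {q' x : ℝ}, HasDerivAt q q' (-x) →
      HasDerivAt (fun y => q (-y)) (-q') x := fun {q q' x} hq =>
    (hq.comp x (hasDerivAt_neg x)).congr_deriv (by ring)
  -- The two sign changes cancel in `u_x`, so `c(u_x)` keeps its sign of dependence and the equation
  -- is preserved without any symmetry of `c`.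
  refine ⟨fun t x => -u t (-x), fun t x => -ut t (-x), fun t x => ux t (-x),
    fun t x => -utt t (-x), fun t x => utx t (-x), fun t x => -uxx t (-x),
    { cont_u := (cont h.cont_u).neg
      cont_ut := (cont h.cont_ut).neg
      cont_ux := cont h.cont_ux
      cont_utt := (cont h.cont_utt).neg
      cont_utx := cont h.cont_utx
      cont_uxx := (cont h.cont_uxx).neg
      deriv_t := fun t ht x => (h.deriv_t t ht (-x)).neg
      deriv_x := fun t ht x => (dx (h.deriv_x t ht (-x))).neg.congr_deriv (neg_neg _)
      deriv_tt := fun t ht x => (h.deriv_tt t ht (-x)).neg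
      deriv_tx := fun t ht x => (dx (h.deriv_tx t ht (-x))).neg.congr_deriv (neg_neg _)
      deriv_xt := fun t ht x => h.deriv_xt t ht (-x)
      deriv_xx := fun t ht x => dx (h.deriv_xx t ht (-x))
      mem_domain := fun t ht x => h.mem_domain t ht (-x)
      equation := fun t ht x => by linear_combination -h.equation t ht (-x)
      initial_u := fun x => by simp only [h.initial_u]
      initial_ut := fun x => by simp only [h.initial_ut] }, M, fun t ht x => ?_⟩
  simpa only [abs_neg] using hM t ht (-x)

/-- Initial values of the derivatives of a classical solution. -/
theorem IsClassicalSolution.initial_derivs {c : ℝ → ℝ} {U : Set ℝ} {f g f' f'' g' : ℝ → ℝ} {T : ℝ}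
    {u ut ux utt utx uxx : ℝ → ℝ → ℝ} (h : IsClassicalSolution c U f g T u ut ux utt utx uxx)
    (hT : 0 < T) (hf : ∀ x, HasDerivAt f (f' x) x) (hf' : ∀ x, HasDerivAt f' (f'' x) x)
    (hg : ∀ x, HasDerivAt g (g' x) x) (x : ℝ) :
    ux 0 x = f' x ∧ utx 0 x = g' x ∧ uxx 0 x = f'' x := by
  have T0 : (0 : ℝ) ∈ Ico 0 T := ⟨le_rfl, hT⟩
  have e1 : ∀ x, ux 0 x = f' x := fun x => by
    have := h.deriv_x 0 T0 x
    rw [show (fun y => u 0 y) = f from funext h.initial_u] at this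
    exact this.unique (hf x)
  refine ⟨e1 x, ?_, ?_⟩
  · have := h.deriv_tx 0 T0 x
    rw [show (fun y => ut 0 y) = g from funext h.initial_ut] at this
    exact this.unique (hg x)
  · have := h.deriv_xx 0 T0 x
    rw [show (fun y => ux 0 y) = f' from funext e1] at this
    exact this.unique (hf' x)

/-- With `X = ε^(-1/p)` this absorbs the factor `1/ε = X^p` of the blow-up time into the
exponential. -/
theorem rpow_le_mul_exp {p X : ℝ} (hp : 0 < p) (hX : 0 ≤ X) : X ^ p ≤ p ^ p * Real.exp X := by
  have h1 : X ≤ p * Real.exp (X / p) := by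
    have := Real.add_one_le_exp (X / p)
    calc X = p * (X / p) := by field_simp
      _ ≤ p * Real.exp (X / p) := by gcongr; linarith
  calc X ^ p ≤ (p * Real.exp (X / p)) ^ p := Real.rpow_le_rpow hX h1 hp.le
    _ = p ^ p * Real.exp X := by
      rw [Real.mul_rpow hp.le (Real.exp_pos _).le, ← Real.exp_mul]
      congr 2; field_simp

set_option maxHeartbeats 800000 in
/-- Upper bound for the lifespan when the invariant `u_t + ∫ c(u_x)` increases somewhere. -/
theorem lifespan_le_of_exists_pos {s : ℝ} (hs : 1 < s) {U : Set ℝ} (hU : IsOpen U)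
    (hU0 : (0 : ℝ) ∈ U) {c : ℝ → ℝ} (hc : MemGevrey s U c) (hc0 : c 0 = 1)
    (hflat : ∀ m : ℕ, 1 ≤ m → iteratedDeriv m c 0 = 0)
    {φ ψ : ℝ → ℝ} (hφ : MemCb 2 φ) (hψ : MemCb 1 ψ) {C C' : ℝ} (hC : 0 < C) (hC' : 0 < C')
    (hlow : ∀ᶠ θ in 𝓝[≠] (0 : ℝ), C * Real.exp (-C' * |θ| ^ (-(1 / (s - 1)))) ≤ deriv c θ)
    (limφ : Tendsto (deriv φ) (cocompact ℝ) (𝓝 0)) (limψ : Tendsto ψ (cocompact ℝ) (𝓝 0))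
    {x₀ : ℝ} (hx₀ : 0 < deriv ψ x₀ + deriv (deriv φ) x₀) :
    ∃ ε₀ > (0 : ℝ), ∃ C₃ > (0 : ℝ), ∃ C₄ > (0 : ℝ), ∀ ε : ℝ, 0 < ε → ε ≤ ε₀ → ∀ T : ℝ, 0 < T →
      HasBoundedSolution c U (fun x => ε * φ x) (fun x => ε * ψ x) T →
      T ≤ C₃ * Real.exp (C₄ * ε ^ (-(1 / (s - 1)))) := by
  obtain ⟨δ₀, hδ₀, K, hK, _, -, k, k', hk, ck', bk', k1, k'0, hkc⟩ :=
    exists_flat_global_speed hs hU hU0 hc hc0 hflat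
  have hp : 0 < s - 1 := by linarith
  set p := s - 1
  obtain ⟨δ, hδ, hδδ, hlowk⟩ : ∃ δ > 0, δ ≤ δ₀ ∧ ∀ θ, |θ| ≤ δ → θ ≠ 0 →
      C * Real.exp (-C' * |θ| ^ (-(1 / p))) ≤ k' θ := by
    rw [eventually_nhdsWithin_iff, Metric.nhds_basis_closedBall.eventually_iff] at hlow
    obtain ⟨δ₁, hδ₁, h⟩ := hlow
    refine ⟨min δ₀ δ₁, by positivity, min_le_left _ _, fun θ hθ h0 => ?_⟩
    rw [(hkc θ (hθ.trans (min_le_left _ _))).2.2.1]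
    exact h (by simpa using hθ.trans (min_le_right _ _)) h0
  have hk'nn : ∀ θ, |θ| ≤ δ → 0 ≤ k' θ := fun θ hθ => by
    rcases eq_or_ne θ 0 with rfl | h0
    · exact k'0.ge
    · exact (by positivity : 0 ≤ C * Real.exp (-C' * |θ| ^ (-(1 / p)))).trans (hlowk θ hθ h0)
  have k0 : k 0 = 1 := by rw [(hkc 0 (by simpa using hδ₀.le)).2.1, hc0]
  have ck : Continuous k := continuous_iff_continuousAt.2 fun θ => (hk θ).continuousAt
  obtain ⟨F, V, hF, -, -, bF, -⟩ := exists_primitive_inverse ck k1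
  have F0 : F 0 = 0 := by simpa using bF 0
  obtain ⟨dφ, ddφ, dψ, cφ'', cψ', M, hM, hbd⟩ := exists_data_bound hφ hψ
  have hM0 : 0 < M := by linarith
  -- a point where the invariant of the linearised problem is nonzero and increasing
  obtain ⟨a, haσ, hab⟩ : ∃ a, ψ a + deriv φ a ≠ 0 ∧ 0 < deriv ψ a + deriv (deriv φ) a := by
    -- A nonzero derivative at `x₀` prevents `ψ + φ'` from vanishing at nearby points other than
    -- `x₀`, even if it vanishes at `x₀` itself.
    have h1 := ((dψ x₀).add (ddφ x₀)).eventually_ne (c := 0) hx₀.ne'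
    have h2 : ∀ᶠ x in 𝓝[≠] x₀, 0 < deriv ψ x + deriv (deriv φ) x :=
      nhdsWithin_le_nhds ((cψ'.add cφ'').continuousAt.eventually (lt_mem_nhds hx₀))
    exact (h1.and h2).exists
  set σ := |ψ a + deriv φ a| with hσdef
  have hσ : 0 < σ := abs_pos.2 haσ
  set b := deriv ψ a + deriv (deriv φ) a with hbdef
  -- decay of the other invariant
  obtain ⟨N, hN⟩ : ∃ N, ∀ y ≤ N, |deriv φ y| ≤ σ / 16 ∧ |ψ y| ≤ σ / 16 := by
    have h1 := (limφ.mono_left atBot_le_cocompact).eventually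
      (Metric.closedBall_mem_nhds (0 : ℝ) (by positivity : 0 < σ / 16))
    have h2 := (limψ.mono_left atBot_le_cocompact).eventually
      (Metric.closedBall_mem_nhds (0 : ℝ) (by positivity : 0 < σ / 16))
    obtain ⟨N, hN⟩ := eventually_atBot.1 (h1.and h2)
    exact ⟨N, fun y hy => by simpa using hN y hy⟩
  -- nonlinear corrections are negligible for small data
  obtain ⟨ε₁, hε₁, hsmall⟩ : ∃ ε₁ > 0, ∀ ε, 0 < ε → ε ≤ ε₁ →
      |F (ε * deriv φ a) - ε * deriv φ a| ≤ σ / 2 * ε ∧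
      |k (ε * deriv φ a) - 1| * |deriv (deriv φ) a| ≤ b / 2 := by
    have h1 : ∀ᶠ ε in 𝓝 (0 : ℝ), |F (ε * deriv φ a) - ε * deriv φ a| ≤ σ / 2 * |ε| := by
      have hd : HasDerivAt (fun ε => F (ε * deriv φ a)) (deriv φ a) 0 := by
        have := HasDerivAt.comp (0 : ℝ) (hF (0 * deriv φ a)) (hasDerivAt_mul_const (deriv φ a))
        rwa [zero_mul, k0, one_mul] at this
      have := (hasDerivAt_iff_isLittleO.1 hd).def (by positivity : 0 < σ / 2)
      simpa [F0] using this
    have h2 : ∀ᶠ ε in 𝓝 (0 : ℝ), |k (ε * deriv φ a) - 1| * |deriv (deriv φ) a| < b / 2 := by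
      have hc2 : Continuous fun ε => |k (ε * deriv φ a) - 1| * |deriv (deriv φ) a| := by fun_prop
      refine hc2.continuousAt.eventually (gt_mem_nhds ?_)
      beta_reduce; rw [zero_mul, k0]; simpa using hab
    obtain ⟨ε₁, hε₁, h⟩ := Metric.nhds_basis_closedBall.eventually_iff.1 (h1.and h2)
    refine ⟨ε₁, hε₁, fun ε hε hle => ?_⟩
    have := h (x := ε) (by simpa [abs_of_pos hε] using hle)
    rw [abs_of_pos hε] at this
    exact ⟨this.1, this.2.le⟩
  -- For `x ≤ a` and `t ≥ t₀` the foot of the `R`-characteristic satisfies `y ≤ a - 1.98 (|a| + |N|)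
  -- ≤ N`.
  set t₀ := 2 * (|a| + |N|) with ht₀
  have t₀nn : 0 ≤ t₀ := by positivity
  set C'' := C' * (σ / 9) ^ (-(1 / p)) with hC''
  -- `time_le` with initial slope at least `ε b / 2` gives the time `t₀ + 6 / (ϑ ε b)`; the `+ 1` in
  -- the exponent pays for `1/ε`.
  refine ⟨min ε₁ (δ / (8 * M)), by positivity, t₀ + 6 * p ^ p / (C * b), by positivity, C'' + 1,
    by positivity, fun ε hε hεle T hT hsol => ?_⟩
  have hε8 : 8 * (ε * M) ≤ δ := by
    have := hεle.trans (min_le_right _ _)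
    rw [le_div_iff₀ (by positivity)] at this
    linarith
  obtain ⟨hs1, hs2⟩ := hsmall ε hε (hεle.trans (min_le_left _ _))
  set X := ε ^ (-(1 / p)) with hXdef
  have hX0 : 0 < X := by positivity
  set ϑ := C * Real.exp (-(C'' * X)) with hϑdef
  have hϑ0 : 0 < ϑ := by positivity
  have bound : t₀ + 6 / (ϑ * ε * b) ≤
      (t₀ + 6 * p ^ p / (C * b)) * Real.exp ((C'' + 1) * X) := by
    have e1 : 1 / ε = X ^ p := by
      rw [hXdef, ← Real.rpow_mul hε.le, show -(1 / p) * p = -1 by field_simp, Real.rpow_neg_one,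
        one_div]
    have e2 := rpow_le_mul_exp hp hX0.le
    rw [← e1] at e2
    have e3 : 1 ≤ Real.exp ((C'' + 1) * X) := Real.one_le_exp (by positivity)
    have e4 : 6 / (ϑ * ε * b) = 6 / (C * b) * Real.exp (C'' * X) * (1 / ε) := by
      rw [hϑdef, Real.exp_neg]; field_simp
    have e5 : Real.exp ((C'' + 1) * X) = Real.exp (C'' * X) * Real.exp X := by
      rw [← Real.exp_add]; ring_nf
    rw [add_mul]
    refine add_le_add (le_mul_of_one_le_right t₀nn e3) ?_
    rw [e4, e5]
    calc 6 / (C * b) * Real.exp (C'' * X) * (1 / ε)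
        ≤ 6 / (C * b) * Real.exp (C'' * X) * (p ^ p * Real.exp X) := by gcongr
      _ = _ := by ring
  refine le_trans ?_ bound
  obtain ⟨u, ut, ux, utt, utx, uxx, h, M', hM'⟩ := hsol
  have init := h.initial_derivs hT (fun x => (dφ x).const_mul ε) (fun x => (ddφ x).const_mul ε)
    (fun x => (dψ x).const_mul ε)
  have bxx : ∀ t ∈ Ico 0 T, ∀ x, |uxx t x| ≤ M' := fun t ht x => (hM' t ht x).2.2.2.2.2.1
  have btx : ∀ t ∈ Ico 0 T, ∀ x, |utx t x| ≤ M' := fun t ht x => (hM' t ht x).2.2.2.2.1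
  have hkc' : ∀ θ, |θ| ≤ δ → k θ = c θ := fun θ hθ => (hkc θ (hθ.trans hδδ)).2.1
  have confined : ∀ t ∈ Ico 0 T, ∀ x, |ux t x| ≤ δ := fun t ht x =>
    (h.abs_ux_le bxx btx hk bk' k1 hδ hkc' hε8
      (fun x => by
        rw [(init x).1, abs_mul, abs_of_pos hε]
        exact mul_le_mul_of_nonneg_left (hbd x).2.1 hε.le)
      (fun x => by
        rw [abs_mul, abs_of_pos hε]
        exact mul_le_mul_of_nonneg_left (hbd x).2.2.2.1 hε.le) ht x).trans (by
          have : 0 < ε * M := by positivity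
          linarith)
  refine le_of_forall_lt fun τ hτT => ?_
  by_contra! hτ
  -- enlarge the slab so that the inequality is strict
  obtain ⟨τ', hττ', hτ'T⟩ := exists_between hτT
  have hpos : 0 ≤ 6 / (ϑ * ε * b) := by positivity
  have hτ' : τ' ∈ Ico 0 T := ⟨by linarith, hτ'T⟩
  have slab := h.isSlabSolution bxx btx hkc' hτ'
    (fun t ht x => confined t ⟨ht.1, ht.2.trans_lt hτ'T⟩ x)
  have e0 : projIcc 0 τ' hτ'.1 0 = ⟨0, left_mem_Icc.2 hτ'.1⟩ := projIcc_of_mem _ _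
  have mem : ∀ t, (projIcc 0 τ' hτ'.1 t : ℝ) ∈ Ico 0 T := fun t =>
    ⟨(projIcc 0 τ' hτ'.1 t).2.1, (projIcc 0 τ' hτ'.1 t).2.2.trans_lt hτ'.2⟩
  have Sx : ε * b / 2 ≤ utx 0 a + k (ux 0 a) * uxx 0 a := by
    obtain ⟨i1, i2, i3⟩ := init a
    rw [i1, i2, i3]
    have e : ε * deriv ψ a + k (ε * deriv φ a) * (ε * deriv (deriv φ) a) =
        ε * (b + (k (ε * deriv φ a) - 1) * deriv (deriv φ) a) := by rw [hbdef]; ring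
    rw [e, mul_div_assoc]
    refine mul_le_mul_of_nonneg_left ?_ hε.le
    have := neg_abs_le ((k (ε * deriv φ a) - 1) * deriv (deriv φ) a)
    rw [abs_mul] at this
    linarith
  have hS0 : σ / 2 * ε ≤ |ut 0 a + F (ux 0 a)| := by
    rw [h.initial_ut, (init a).1]
    have e : ε * (ψ a + deriv φ a) = (ε * ψ a + F (ε * deriv φ a)) -
        (F (ε * deriv φ a) - ε * deriv φ a) := by ring
    have e2 : |ε * (ψ a + deriv φ a)| = ε * σ := by rw [abs_mul, abs_of_pos hε]
    have := abs_sub (ε * ψ a + F (ε * deriv φ a)) (F (ε * deriv φ a) - ε * deriv φ a)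
    rw [← e, e2] at this
    linarith
  have key := slab.time_le hk ck' bk' k1 hF (fun t _ x => hk'nn _ (confined _ (mem t) x))
    (a := a) (t₀ := t₀) (ϑ := ϑ) t₀nn (by linarith) hϑ0
    (fun t ht x hx hinv => by
      have htI : t ∈ Icc 0 τ' := ⟨t₀nn.trans ht.1, ht.2⟩
      obtain ⟨y, hy, hR⟩ := slab.exists_foot hk bk' k1 hF (σ := -1) (by simp) htI x
      have hyN : y ≤ N := by
        have := hy rfl
        have := ht.1
        linarith [neg_abs_le N, le_abs_self a, abs_nonneg a, abs_nonneg N]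
      simp only [e0] at hinv hR
      simp only
      have hv := confined _ (mem t) x
      generalize ux (projIcc 0 τ' hτ'.1 t) x = v at hinv hR hv
      generalize ut (projIcc 0 τ' hτ'.1 t) x = w at hinv hR
      have hR0 : |ut 0 y + -1 * F (ux 0 y)| ≤ σ / 4 * ε := by
        rw [h.initial_ut, (init y).1]
        obtain ⟨n1, n2⟩ := hN y hyN
        have b1 : |ε * ψ y| ≤ ε * (σ / 16) := by
          rw [abs_mul, abs_of_pos hε]; exact mul_le_mul_of_nonneg_left n2 hε.le
        have b2 : |F (ε * deriv φ y)| ≤ 101 / 100 * (ε * (σ / 16)) := by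
          refine (bF _).trans ?_
          rw [abs_mul, abs_of_pos hε]
          gcongr
        refine (abs_add_le _ _).trans ?_
        rw [neg_one_mul, abs_neg]
        linarith [mul_pos hσ hε]
      have hF2 : 2 * F v = (ut 0 a + F (ux 0 a)) - (ut 0 y + -1 * F (ux 0 y)) := by
        rw [← hinv, ← hR]; ring
      have hFv : σ / 4 * ε ≤ 2 * |F v| := by
        have h1 := abs_sub_abs_le_abs_sub (ut 0 a + F (ux 0 a)) (ut 0 y + -1 * F (ux 0 y))
        rw [← hF2, abs_mul, abs_two] at h1
        linarith
      -- `|S| ≥ σ ε / 2` and `|R| ≤ σ ε / 4` leave `|F v| ≥ σ ε / 8`, and `8 · 1.01 ≤ 9`.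
      have hvlow : σ / 9 * ε ≤ |v| := by linarith [bF v, mul_pos hσ hε]
      have hvpos : 0 < |v| := lt_of_lt_of_le (by positivity) hvlow
      refine le_trans ?_ (hlowk v hv (abs_pos.1 hvpos))
      have hr : |v| ^ (-(1 / p)) ≤ (σ / 9) ^ (-(1 / p)) * X := by
        rw [hXdef, ← Real.mul_rpow (by positivity) hε.le]
        exact Real.rpow_le_rpow_of_nonpos (by positivity) hvlow (by rw [neg_nonpos]; positivity)
      rw [hϑdef, neg_mul, hC'', mul_assoc]
      gcongr)
    (by
      simp only [e0]
      exact lt_of_lt_of_le (by positivity) Sx)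
  simp only [e0] at key
  have hlt : 0 < τ' - t₀ := by linarith
  have h1 : ϑ * (τ' - t₀) * (ε * b / 2) ≤ 3 := by
    refine le_trans ?_ key
    gcongr
  have h2 : τ' - t₀ ≤ 6 / (ϑ * ε * b) := by
    rw [le_div_iff₀ (by positivity)]
    linarith
  linarith

theorem MemCb.reflect {m : ℕ} {f : ℝ → ℝ} (hf : MemCb m f) : MemCb m fun x => -f (-x) := by
  refine ⟨(hf.1.comp contDiff_neg).neg, fun k hk => ?_⟩
  obtain ⟨M, hM⟩ := hf.2 k hk
  refine ⟨M, fun x => ?_⟩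
  have e : iteratedDeriv k (fun x => -f (-x)) x = -((-1 : ℝ) ^ k * iteratedDeriv k f (-x)) := by
    rw [iteratedDeriv_fun_neg, iteratedDeriv_comp_neg, smul_eq_mul]
  rw [e, abs_neg, abs_mul, abs_pow, abs_neg, abs_one, one_pow, one_mul]
  exact hM _

theorem deriv_neg_comp_neg (f : ℝ → ℝ) : deriv (fun x => -f (-x)) = fun x => deriv f (-x) := by
  funext x
  rw [deriv.fun_neg, deriv_comp_neg, neg_neg]

theorem lifespan_le {c : ℝ → ℝ} {U : Set ℝ} {f g : ℝ → ℝ} {B : ℝ}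
    (h : ∀ T, 0 < T → HasBoundedSolution c U f g T → T ≤ B) :
    lifespan c U f g ≤ ENNReal.ofReal B := by
  refine sSup_le ?_
  rintro _ ⟨T, hT, hsol, rfl⟩
  exact ENNReal.ofReal_le_ofReal (h T hT hsol)

theorem theorem7 (s : ℝ) (hs : 1 < s) (U : Set ℝ) (hU : IsOpen U) (hU0 : (0 : ℝ) ∈ U)
    (c : ℝ → ℝ) (hc : MemGevrey s U c) (hc0 : c 0 = 1)
    (hflat : ∀ m : ℕ, 1 ≤ m → iteratedDeriv m c 0 = 0)
    (φ ψ : ℝ → ℝ) (hφ : MemCb 2 φ) (hψ : MemCb 1 ψ) :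
    (∃ ε₀ > (0 : ℝ), ∃ C₁ > (0 : ℝ), ∃ C₂ > (0 : ℝ), ∀ ε : ℝ, 0 < ε → ε ≤ ε₀ →
      ENNReal.ofReal (C₁ * Real.exp (C₂ * ε ^ (-(1 / (s - 1))))) ≤
        lifespan c U (fun x => ε * φ x) (fun x => ε * ψ x)) ∧
    ((∃ C > (0 : ℝ), ∃ C' > (0 : ℝ), ∀ᶠ θ in 𝓝[≠] (0 : ℝ),
        C * Real.exp (-C' * |θ| ^ (-(1 / (s - 1)))) ≤ deriv c θ) →
      Tendsto (deriv φ) (cocompact ℝ) (𝓝 0) →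
      Tendsto ψ (cocompact ℝ) (𝓝 0) →
      (∃ x₀ : ℝ, 0 < deriv ψ x₀ + deriv (deriv φ) x₀ ∨ 0 < deriv ψ x₀ - deriv (deriv φ) x₀) →
      ∃ ε₀ > (0 : ℝ), ∃ C₃ > (0 : ℝ), ∃ C₄ > (0 : ℝ), ∀ ε : ℝ, 0 < ε → ε ≤ ε₀ →
        lifespan c U (fun x => ε * φ x) (fun x => ε * ψ x) ≤
          ENNReal.ofReal (C₃ * Real.exp (C₄ * ε ^ (-(1 / (s - 1)))))) := by
  refine ⟨le_lifespan hs hU hU0 hc hc0 hflat hφ hψ, ?_⟩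
  rintro ⟨C, hC, C', hC', hlow⟩ limφ limψ ⟨x₀, hx₀ | hx₀⟩
  · obtain ⟨ε₀, hε₀, C₃, hC₃, C₄, hC₄, h⟩ := lifespan_le_of_exists_pos hs hU hU0 hc hc0 hflat hφ hψ
      hC hC' hlow limφ limψ hx₀
    exact ⟨ε₀, hε₀, C₃, hC₃, C₄, hC₄, fun ε hε hle => lifespan_le (h ε hε hle)⟩
  -- For the reflected data, `ψ_x + φ_xx` at `-x₀` equals the original `ψ_x - φ_xx` at `x₀`.
  · have neg_lim : Tendsto (fun x : ℝ => -x) (cocompact ℝ) (cocompact ℝ) :=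
      (Homeomorph.neg ℝ).isClosedEmbedding.tendsto_cocompact
    obtain ⟨ε₀, hε₀, C₃, hC₃, C₄, hC₄, h⟩ := lifespan_le_of_exists_pos hs hU hU0 hc hc0 hflat
      hφ.reflect hψ.reflect hC hC' hlow (by rw [deriv_neg_comp_neg]; exact limφ.comp neg_lim)
      (by simpa using (limψ.comp neg_lim).neg) (x₀ := -x₀) (by
        rw [deriv_neg_comp_neg, deriv_neg_comp_neg, deriv_comp_neg]
        simpa [sub_eq_add_neg] using hx₀)
    refine ⟨ε₀, hε₀, C₃, hC₃, C₄, hC₄, fun ε hε hle => lifespan_le fun T hT hsol => ?_⟩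
    refine h ε hε hle T hT ?_
    simpa only [mul_neg] using hsol.reflect
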